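/- For $\theta\in\mathbb{R}$ put $\gamma=e^{\mathrm{i}\theta}$ and let $\mathfrak{N}_\theta$ be the $8$-dimensional subspace of $4\times 4$ complex matrices $$\mathfrak{N}_\theta=\left\{\begin{bmatrix} a&b&e&f\\ c&d&f&\bar\gamma e\\ g&h&a&b\\ h&\gamma g&c&d\end{bmatrix} : a,b,c,d,e,f,g,h\in\mathbb{C}\right\}.$$ A (finite-outcome) quantum observable on $\mathbb{C}^n$ is a finite family $\mathcal{M}=\{M_k\}$ of positive semidefinite operators with $\sum_k M_k=I$; the tensor product of $\{M_k\}$ and $\{N_l\}$ is $\{M_k\otimes N_l\}_{k,l}$. A subspace $\mathcal{H}_0$ of dimension at least $2$ is called indistinguishable for $\mathcal{M}$ if all states (density operators) $\rho$ supported by $\mathcal{H}_0$ give the same outcome probability distribution $k\mapsto\operatorname{Tr}(\rho M_k)$. Let $\theta_1,\theta_2,\theta_3>0$ with $\theta_1+\theta_2+\theta_3=\pi$, and for each $i=1,2,3$ let $\mathcal{M}_{\theta_i}=\{M^{\theta_i}_k\}_{k=1}^8$ be any basis of $\mathfrak{N}_{\theta_i}$ consisting of positive semidefinite operators with $\sum_{k=1}^8M^{\theta_i}_k=I$.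 Then none of the observables $\mathcal{M}_{\theta_i}$ and none of the bipartite observables $\mathcal{M}_{\theta_i}\otimes\mathcal{M}_{\theta_j}$ with $i\neq j$ has an indistinguishable subspace, but the two-dimensional subspace of $\mathbb{C}^4\otimes\mathbb{C}^4\otimes\mathbb{C}^4$ spanned by $$|\varphi\rangle=\tfrac{1}{\sqrt2}\left[\,|111\rangle+\mathrm{i}\,|222\rangle\,\right],\qquad |\psi\rangle=\tfrac{1}{\sqrt2}\left[\,|333\rangle+\mathrm{i}\,|444\rangle\,\right],$$ where $|1\rangle,\dots,|4\rangle$ is the canonical basis of $\mathbb{C}^4$, is indistinguishable for the tripartite observable $\mathcal{M}_{\theta_1}\otimes\mathcal{M}_{\theta_2}\otimes\mathcal{M}_{\theta_3}$. -/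

import Mathlib

open scoped Matrix ComplexOrder

noncomputable section

namespace NPartite

open Matrix

/-- The operator subspace `𝔑_θ` of `4 × 4` complex matrices, with `γ = exp (i θ)`. -/
def graphSpace (θ : ℝ) : Submodule ℂ (Matrix (Fin 4) (Fin 4) ℂ) where
  carrier := {M | ∃ a b c d e f g h : ℂ,
    M = !![a, b, e, f;
           c, d, f, star (Complex.exp (Complex.I * θ)) * e;
           g, h, a, b;
           h, Complex.exp (Complex.I * θ) * g, c, d]}
  zero_mem' := by
    refine ⟨0, 0, 0, 0, 0, 0, 0, 0, ?_⟩
    ext i j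
    fin_cases i <;> fin_cases j <;> simp
  add_mem' := by
    rintro _ _ ⟨a, b, c, d, e, f, g, h, rfl⟩ ⟨a', b', c', d', e', f', g', h', rfl⟩
    refine ⟨a + a', b + b', c + c', d + d', e + e', f + f', g + g', h + h', ?_⟩
    ext i j
    fin_cases i <;> fin_cases j <;> simp [mul_add]
  smul_mem' := by
    rintro z _ ⟨a, b, c, d, e, f, g, h, rfl⟩
    refine ⟨z * a, z * b, z * c, z * d, z * e, z * f, z * g, z * h, ?_⟩
    ext i j
    fin_cases i <;> fin_cases j <;> simp [mul_left_comm]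

/-- A quantum observable with finitely many outcomes: positive operators with sum `I`. -/
structure IsObservable {n κ : Type*} [Fintype n] [DecidableEq n] [Fintype κ]
    (M : κ → Matrix n n ℂ) : Prop where
  posSemidef : ∀ k, (M k).PosSemidef
  sum_eq_one : ∑ k, M k = 1

/-- The family `M` is a linear basis of the subspace `𝔏` of matrices. -/
structure IsBasisOf {n κ : Type*} (M : κ → Matrix n n ℂ) (𝔏 : Submodule ℂ (Matrix n n ℂ)) :
    Prop where
  linearIndependent : LinearIndependent ℂ M
  span_eq : Submodule.span ℂ (Set.range M) = 𝔏

/-- The tensor product of two observables, with outcomes `(k, l)` and effects `M k ⊗ N l`. -/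
def tensor {m n κ ι : Type*} (M : κ → Matrix m m ℂ) (N : ι → Matrix n n ℂ) :
    κ × ι → Matrix (m × n) (m × n) ℂ :=
  fun k => Matrix.kronecker (M k.1) (N k.2)

/-- A quantum state (density operator). -/
structure IsState {n : Type*} [Fintype n] (ρ : Matrix n n ℂ) : Prop where
  posSemidef : ρ.PosSemidef
  trace_eq_one : ρ.trace = 1

/-- The operator `ρ` is supported by the subspace `H`: its range lies in `H`. -/
def SupportedBy {n : Type*} [Fintype n] (ρ : Matrix n n ℂ)
    (H : Submodule ℂ (EuclideanSpace ℂ n)) : Prop :=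
  ∀ v : n → ℂ, WithLp.toLp 2 (ρ *ᵥ v) ∈ H

/-- The outcome probabilities `Tr (ρ M_k)` of the observable `M` in the state `ρ`. -/
def outcomeDistribution {n κ : Type*} [Fintype n] (M : κ → Matrix n n ℂ) (ρ : Matrix n n ℂ) :
    κ → ℂ :=
  fun k => (ρ * M k).trace

/-- All states supported by `H` give the same outcome distribution of `M`. -/
def IsIndistinguishable {n κ : Type*} [Fintype n] (M : κ → Matrix n n ℂ)
    (H : Submodule ℂ (EuclideanSpace ℂ n)) : Prop :=
  ∀ ρ σ : Matrix n n ℂ, IsState ρ → IsState σ → SupportedBy ρ H → SupportedBy σ H →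
    outcomeDistribution M ρ = outcomeDistribution M σ

/-- `M` has an indistinguishable subspace of dimension at least two
(subspaces of dimension `0` and `1` carry at most one state). -/
def HasIndistinguishableSubspace {n κ : Type*} [Fintype n] (M : κ → Matrix n n ℂ) : Prop :=
  ∃ H : Submodule ℂ (EuclideanSpace ℂ n), 2 ≤ Module.finrank ℂ H ∧ IsIndistinguishable M H

/-- The canonical basis vector `|i⟩ ⊗ |i⟩ ⊗ |i⟩` of `ℂ⁴ ⊗ ℂ⁴ ⊗ ℂ⁴` (indices start at `0`). -/
def ket3 (i : Fin 4) : EuclideanSpace ℂ (Fin 4 × Fin 4 × Fin 4) :=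
  EuclideanSpace.single (i, i, i) 1

/-- `|φ⟩ = (|111⟩ + i |222⟩) / √2`. -/
def phi : EuclideanSpace ℂ (Fin 4 × Fin 4 × Fin 4) :=
  ((1 / Real.sqrt 2 : ℝ) : ℂ) • (ket3 0 + Complex.I • ket3 1)

/-- `|ψ⟩ = (|333⟩ + i |444⟩) / √2`. -/
def psi : EuclideanSpace ℂ (Fin 4 × Fin 4 × Fin 4) :=
  ((1 / Real.sqrt 2 : ℝ) : ℂ) • (ket3 2 + Complex.I • ket3 3)

end NPartite

end

open Matrix

namespace NPartite

/-! Indistinguishability of the plane spanned by orthonormal `φ₀`, `φ₁` amounts to the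
Knill–Laflamme conditions `⟨φᵢ|M_k|φⱼ⟩ = δᵢⱼ Λ_k`. These are linear in `M_k`, so they pass from the
effects to all of `𝔑_θ`, or to products of elements of two or three such spaces.

Three parties: the entry between `phi` and `psi` is `½ e e' e'' (1 + conj (γ₁γ₂γ₃))`, the `f`-terms
cancelling because of the factor `i`. It vanishes since `γ₁γ₂γ₃ = e^{iπ} = -1`. The diagonal blocks
of every element of `𝔑_θ` coincide, which settles the remaining condition.

Two parties: with `ℂ⁴ = ℂ² ⊗ ℂ²`, the space `𝔑_θ` contains every `I ⊗ X` and the off-diagonal block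
`d = diag (e^{iθ/2}, e^{-iθ/2})`. As `θ₁ + θ₂ < π`, the numbers `d₁ x`, `d₂ y` and `d₁ x * d₂ y`
have positive real part, so that `tr (A† d₁ A d₂) = 0` only for `A = 0` (`re_trace_pos`). The
conditions for `X ⊗ Y` on the inner factors give the two code vectors a common decomposition of rank
`r ≤ 2` (`exists_common_decomposition`). For `r = 1` the conditions become scalar and contradictory.
For `r = 2` the coefficients form four orthonormal `2 × 2` matrices, which `det_eq_zero_of_isScalar`
forces to be singular: an orthonormal product basis of `ℂ² ⊗ ℂ²`. Such a basis has few orthogonality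
patterns, and `ProductCode.false` refutes each by positivity.

One party reduces to two by tensoring the code with a fixed vector. -/

/-! ### Sesquilinear forms and the Knill–Laflamme conditions -/

/-- The sesquilinear form `⟨φ|A|ψ⟩`. -/
def sesq {n : Type*} [Fintype n] (A : Matrix n n ℂ) (φ ψ : n → ℂ) : ℂ :=
  star φ ⬝ᵥ (A *ᵥ ψ)

/-- A `2 × 2` array is scalar if it is a multiple of the identity array. -/
def IsScalar {V : Type*} [Zero V] (X : Fin 2 → Fin 2 → V) : Prop :=
  ∃ Λ, ∀ i j, X i j = if i = j then Λ else 0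

lemma isScalar_iff {V : Type*} [Zero V] (X : Fin 2 → Fin 2 → V) :
    IsScalar X ↔ X 0 1 = 0 ∧ X 1 0 = 0 ∧ X 0 0 = X 1 1 := by
  constructor
  · rintro ⟨Λ, h⟩
    simp [h]
  · rintro ⟨h1, h2, h3⟩
    refine ⟨X 1 1, fun i j => ?_⟩
    fin_cases i <;> fin_cases j <;> simp [h1, h2, h3]

section Sesq

variable {n : Type*} [Fintype n]

lemma sesq_eq_sum (A : Matrix n n ℂ) (φ ψ : n → ℂ) :
    sesq A φ ψ = ∑ i, ∑ j, A i j * (star (φ i) * ψ j) := by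
  simp only [sesq, dotProduct, mulVec, Finset.mul_sum, Pi.star_apply]
  exact Finset.sum_congr rfl fun i _ => Finset.sum_congr rfl fun j _ => by ring

lemma sesq_add_left (A : Matrix n n ℂ) (φ φ' ψ : n → ℂ) :
    sesq A (φ + φ') ψ = sesq A φ ψ + sesq A φ' ψ := by
  simp [sesq, add_dotProduct]

lemma sesq_add_right (A : Matrix n n ℂ) (φ ψ ψ' : n → ℂ) :
    sesq A φ (ψ + ψ') = sesq A φ ψ + sesq A φ ψ' := by
  simp [sesq, mulVec_add, dotProduct_add]

lemma sesq_smul_left (A : Matrix n n ℂ) (c : ℂ) (φ ψ : n → ℂ) :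
    sesq A (c • φ) ψ = star c * sesq A φ ψ := by
  simp [sesq, star_smul]

lemma sesq_smul_right (A : Matrix n n ℂ) (c : ℂ) (φ ψ : n → ℂ) :
    sesq A φ (c • ψ) = c * sesq A φ ψ := by
  simp [sesq, mulVec_smul, dotProduct_smul]

/-- `A ↦ ⟨φ|A|ψ⟩` as a linear functional. -/
def sesqₗ (φ ψ : n → ℂ) : Matrix n n ℂ →ₗ[ℂ] ℂ where
  toFun A := sesq A φ ψ
  map_add' A B := by simp [sesq, add_mulVec, dotProduct_add]
  map_smul' c A := by simp [sesq, smul_mulVec, dotProduct_smul]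

lemma isState_vecMulVec {χ : n → ℂ} (h : star χ ⬝ᵥ χ = 1) : IsState (vecMulVec χ (star χ)) where
  posSemidef := posSemidef_vecMulVec_self_star χ
  trace_eq_one := by rw [trace_vecMulVec, dotProduct_comm, h]

lemma supportedBy_vecMulVec {χ : n → ℂ} {H : Submodule ℂ (EuclideanSpace ℂ n)}
    (h : WithLp.toLp 2 χ ∈ H) : SupportedBy (vecMulVec χ (star χ)) H := by
  intro v
  rw [vecMulVec_mulVec]
  have := H.smul_mem (star χ ⬝ᵥ v) h
  convert this using 1
  ext i
  simp [mul_comm]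

lemma outcomeDistribution_vecMulVec {κ : Type*} (M : κ → Matrix n n ℂ) (χ : n → ℂ) (k : κ) :
    outcomeDistribution M (vecMulVec χ (star χ)) k = sesq (M k) χ χ := by
  rw [outcomeDistribution, vecMulVec_mul, trace_vecMulVec, sesq, dotProduct_comm,
    dotProduct_mulVec]

/-- An indistinguishable subspace contains a pair of vectors satisfying the
Knill–Laflamme conditions for all effects. -/
lemma HasIndistinguishableSubspace.exists_isScalar {κ : Type*} {M : κ → Matrix n n ℂ}
    (h : HasIndistinguishableSubspace M) :
    ∃ φ : Fin 2 → n → ℂ, φ 0 ≠ 0 ∧ ∀ k, IsScalar fun i j => sesq (M k) (φ i) (φ j) := by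
  obtain ⟨H, hdim, hH⟩ := h
  let b := stdOrthonormalBasis ℂ H
  let f : Fin 2 → n → ℂ := fun i => (b (Fin.castLE hdim i) : EuclideanSpace ℂ n).ofLp
  have hmem : ∀ c d : ℂ, WithLp.toLp 2 (c • f 0 + d • f 1) ∈ H := fun c d =>
    H.add_mem (H.smul_mem c (b _).2) (H.smul_mem d (b _).2)
  have hon : ∀ i j, star (f i) ⬝ᵥ f j = if i = j then 1 else 0 := by
    intro i j
    have := orthonormal_iff_ite.1 b.orthonormal (Fin.castLE hdim i) (Fin.castLE hdim j)
    rw [Submodule.coe_inner, EuclideanSpace.inner_eq_star_dotProduct, dotProduct_comm] at this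
    simpa [f] using this
  have key : ∀ c d : ℂ, star c * c + star d * d = 1 → ∀ k,
      star c * c * sesq (M k) (f 0) (f 0) + star d * c * sesq (M k) (f 1) (f 0) +
        (star c * d * sesq (M k) (f 0) (f 1) + star d * d * sesq (M k) (f 1) (f 1)) =
      sesq (M k) (f 0) (f 0) := by
    intro c d hcd k
    have hu : star (c • f 0 + d • f 1) ⬝ᵥ (c • f 0 + d • f 1) = 1 := by
      simp only [star_add, star_smul, add_dotProduct, dotProduct_add, smul_dotProduct,
        dotProduct_smul, hon, smul_eq_mul]
      simpa [mul_comm] using hcd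
    have hu0 : star (f 0) ⬝ᵥ f 0 = 1 := by simp [hon]
    have := congrFun (hH _ _ (isState_vecMulVec hu) (isState_vecMulVec hu0)
      (supportedBy_vecMulVec (hmem c d))
      (supportedBy_vecMulVec (by simpa using hmem 1 0))) k
    simp only [outcomeDistribution_vecMulVec, sesq_add_left, sesq_add_right, sesq_smul_left,
      sesq_smul_right] at this
    linear_combination this
  refine ⟨f, fun h0 => by simpa [h0] using hon 0 0, fun k => ?_⟩
  -- Polarization: `(0, 1)` equates the diagonal entries, then `(3/5, 4/5)` and `(3/5, 4i/5)` kill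
  -- the sum and the difference of the off-diagonal ones. The Pythagorean triple keeps the unit
  -- vectors rational.
  have h1 := key 0 1 (by simp) k
  have h2 := key (3 / 5) (4 / 5) (by simp; norm_num) k
  have h3 := key (3 / 5) (4 / 5 * Complex.I) (by
    simp; linear_combination (-16 / 25 : ℂ) * Complex.I_sq) k
  simp only [star_div₀, star_mul', star_zero, star_one, Complex.star_def, Complex.conj_I,
    map_ofNat, zero_mul, mul_zero, zero_add, one_mul] at h1 h2 h3
  rw [isScalar_iff]
  refine ⟨?_, ?_, h1.symm⟩
  · linear_combination (25 / 24) * h2 - (25 / 24) * Complex.I * h3 + (-2 / 3 + 2 / 3 * Complex.I) * h1 +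
      (- sesq (M k) (f 1) (f 0) + sesq (M k) (f 0) (f 1)) / 2 * Complex.I_sq -
      2 / 3 * Complex.I * sesq (M k) (f 1) (f 1) * Complex.I_sq
  · linear_combination (25 / 24) * h2 + (25 / 24) * Complex.I * h3 + (-2 / 3 - 2 / 3 * Complex.I) * h1 +
      (sesq (M k) (f 1) (f 0) - sesq (M k) (f 0) (f 1)) / 2 * Complex.I_sq +
      2 / 3 * Complex.I * sesq (M k) (f 1) (f 1) * Complex.I_sq

end Sesq

/-! ### Linear extension of the conditions to spans -/

section Span

variable {n : Type*} [Fintype n]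

/-- Being scalar is the vanishing of three linear functionals. The map `f` allows the tensor factors
to be extended one at a time. -/
lemma isScalar_sesq_of_mem_span {E : Type*} [AddCommGroup E] [Module ℂ E]
    (f : E →ₗ[ℂ] Matrix n n ℂ) (φ : Fin 2 → n → ℂ) {S : Set E}
    (hS : ∀ s ∈ S, IsScalar fun i j => sesq (f s) (φ i) (φ j)) {x : E}
    (hx : x ∈ Submodule.span ℂ S) : IsScalar fun i j => sesq (f x) (φ i) (φ j) := by
  have key : ∀ x, IsScalar (fun i j => sesq (f x) (φ i) (φ j)) ↔
      x ∈ LinearMap.ker (sesqₗ (φ 0) (φ 1) ∘ₗ f) ⊓ LinearMap.ker (sesqₗ (φ 1) (φ 0) ∘ₗ f) ⊓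
        LinearMap.ker (sesqₗ (φ 0) (φ 0) ∘ₗ f - sesqₗ (φ 1) (φ 1) ∘ₗ f) := by
    intro x
    simp [isScalar_iff, sesqₗ, sub_eq_zero, and_assoc]
    rfl
  rw [key]
  exact Submodule.span_le.2 (fun s hs => (key s).1 (hS s hs)) hx

/-- The Knill–Laflamme conditions for a bipartite observable extend to the spans of its parts. -/
lemma isScalar_sesq_kronecker {m κ ι : Type*} [Fintype m]
    {M : κ → Matrix n n ℂ} {N : ι → Matrix m m ℂ}
    {φ : Fin 2 → n × m → ℂ} (h : ∀ k, IsScalar fun i j => sesq (tensor M N k) (φ i) (φ j))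
    {A : Matrix n n ℂ} (hA : A ∈ Submodule.span ℂ (Set.range M))
    {B : Matrix m m ℂ} (hB : B ∈ Submodule.span ℂ (Set.range N)) :
    IsScalar fun i j => sesq (kronecker A B) (φ i) (φ j) := by
  let f : Matrix m m ℂ →ₗ[ℂ] Matrix (n × m) (n × m) ℂ :=
    { toFun := fun B => kronecker A B
      map_add' := kronecker_add A
      map_smul' := fun c B => kronecker_smul c A B }
  refine isScalar_sesq_of_mem_span f φ ?_ hB
  rintro _ ⟨l, rfl⟩
  let g : Matrix n n ℂ →ₗ[ℂ] Matrix (n × m) (n × m) ℂ :=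
    { toFun := fun A => kronecker A (N l)
      map_add' := fun A A' => add_kronecker A A' (N l)
      map_smul' := fun c A => smul_kronecker c A (N l) }
  refine isScalar_sesq_of_mem_span g φ ?_ hA
  rintro _ ⟨k, rfl⟩
  exact h (k, l)

lemma sesq_kronecker {m : Type*} [Fintype m] (A : Matrix n n ℂ) (B : Matrix m m ℂ)
    (φ ψ : n × m → ℂ) :
    sesq (kronecker A B) φ ψ =
      ∑ i, ∑ i', A i i' * ∑ j, ∑ j', B j j' * (star (φ (i, j)) * ψ (i', j')) := by
  rw [sesq_eq_sum]
  simp only [Fintype.sum_prod_type, kronecker, kroneckerMap_apply, Finset.mul_sum]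
  refine Finset.sum_congr rfl fun i _ => ?_
  rw [Finset.sum_comm]
  exact Finset.sum_congr rfl fun i' _ => Finset.sum_congr rfl fun j _ =>
    Finset.sum_congr rfl fun j' _ => by ring

end Span

/-! ### Block form of the graph space and of bipartite vectors -/

/-- The index of `ℂ⁴ = ℂ² ⊗ ℂ²` with block coordinate `s` and inner coordinate `x`. -/
def idx (s x : Fin 2) : Fin 4 := ![![0, 1], ![2, 3]] s x

/-- The matrix `I ⊗ X`. -/
def diagBlock (X : Matrix (Fin 2) (Fin 2) ℂ) : Matrix (Fin 4) (Fin 4) ℂ :=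
  !![X 0 0, X 0 1, 0, 0; X 1 0, X 1 1, 0, 0; 0, 0, X 0 0, X 0 1; 0, 0, X 1 0, X 1 1]

/-- The matrix with the diagonal matrix of `d` in its upper right block. -/
def upperBlock (d : Fin 2 → ℂ) : Matrix (Fin 4) (Fin 4) ℂ :=
  !![0, 0, d 0, 0; 0, 0, 0, d 1; 0, 0, 0, 0; 0, 0, 0, 0]

/-- The matrix with the diagonal matrix of `d` in its lower left block. -/
def lowerBlock (d : Fin 2 → ℂ) : Matrix (Fin 4) (Fin 4) ℂ :=
  !![0, 0, 0, 0; 0, 0, 0, 0; d 0, 0, 0, 0; 0, d 1, 0, 0]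

/-- The diagonal `(e^{iθ/2}, e^{-iθ/2})`. -/
noncomputable def phases (θ : ℝ) : Fin 2 → ℂ :=
  ![Complex.exp (Complex.I * (θ / 2)), star (Complex.exp (Complex.I * (θ / 2)))]

lemma exp_half_mul_self (θ : ℝ) :
    Complex.exp (Complex.I * θ) =
      Complex.exp (Complex.I * (θ / 2)) * Complex.exp (Complex.I * (θ / 2)) := by
  rw [← Complex.exp_add]
  ring_nf

lemma exp_half_mul_star (θ : ℝ) :
    Complex.exp (Complex.I * (θ / 2)) * star (Complex.exp (Complex.I * (θ / 2))) = 1 := by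
  rw [Complex.star_def, ← Complex.exp_conj, ← Complex.exp_add, map_mul, Complex.conj_I,
    show (θ / 2 : ℂ) = ((θ / 2 : ℝ) : ℂ) by push_cast; rfl, Complex.conj_ofReal]
  simp

lemma diagBlock_mem (θ : ℝ) (X : Matrix (Fin 2) (Fin 2) ℂ) : diagBlock X ∈ graphSpace θ :=
  ⟨X 0 0, X 0 1, X 1 0, X 1 1, 0, 0, 0, 0, by simp [diagBlock]⟩

/-- The choice `e = e^{iθ/2}` turns `(e, γ̄ e)` into a conjugate pair, both entries having real part
`cos (θ/2)`. -/
lemma upperBlock_mem (θ : ℝ) : upperBlock (phases θ) ∈ graphSpace θ := by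
  refine ⟨0, 0, 0, 0, phases θ 0, 0, 0, 0, ?_⟩
  have : phases θ 1 = star (Complex.exp (Complex.I * θ)) * phases θ 0 := by
    rw [exp_half_mul_self, star_mul]
    simp only [phases, cons_val_zero, cons_val_one]
    linear_combination (- star (Complex.exp (Complex.I * (θ / 2)))) * exp_half_mul_star θ
  simpa [upperBlock] using this

lemma lowerBlock_mem (θ : ℝ) : lowerBlock (star (phases θ)) ∈ graphSpace θ := by
  refine ⟨0, 0, 0, 0, 0, 0, star (phases θ 0), 0, ?_⟩
  have : star (phases θ 1) = Complex.exp (Complex.I * θ) * star (phases θ 0) := by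
    rw [exp_half_mul_self]
    simp only [phases, cons_val_zero, cons_val_one, star_star]
    linear_combination (- (Complex.exp (Complex.I * (θ / 2)))) * exp_half_mul_star θ
  simpa [lowerBlock] using this

lemma sum_diagBlock_single (x x' : Fin 2) (G : Fin 4 → Fin 4 → ℂ) :
    ∑ i, ∑ i', diagBlock (single x x' 1) i i' * G i i' = ∑ s, G (idx s x) (idx s x') := by
  fin_cases x <;> fin_cases x' <;> simp [diagBlock, idx, Fin.sum_univ_four, single]

lemma sum_upperBlock (d : Fin 2 → ℂ) (G : Fin 4 → Fin 4 → ℂ) :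
    ∑ i, ∑ i', upperBlock d i i' * G i i' = ∑ x, d x * G (idx 0 x) (idx 1 x) := by
  simp [upperBlock, idx, Fin.sum_univ_four]

lemma sum_lowerBlock (d : Fin 2 → ℂ) (G : Fin 4 → Fin 4 → ℂ) :
    ∑ i, ∑ i', lowerBlock d i i' * G i i' = ∑ x, d x * G (idx 1 x) (idx 0 x) := by
  simp [lowerBlock, idx, Fin.sum_univ_four]

/-- Knill–Laflamme conditions for a pair of vectors of `(ℂ² ⊗ ℂ²) ⊗ (ℂ² ⊗ ℂ²)`, given by their
`2 × 2` blocks `Z i s t`, with respect to the products of `I ⊗ X` and of the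
off-diagonal diagonal blocks `d₁`, `d₂`. -/
structure BlockCode (d₁ d₂ : Fin 2 → ℂ)
    (Z : Fin 2 → Fin 2 → Fin 2 → Matrix (Fin 2) (Fin 2) ℂ) : Prop where
  inner : ∀ x y x' y',
    IsScalar fun i j => ∑ s, ∑ t, star (Z i s t x y) * Z j s t x' y'
  upper_upper :
    IsScalar fun i j => ((Z i 0 0)ᴴ * diagonal d₁ * Z j 1 1 * diagonal d₂).trace
  upper_lower :
    IsScalar fun i j => ((Z i 0 1)ᴴ * diagonal d₁ * Z j 1 0 * diagonal (star d₂)).trace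
  upper_diag :
    IsScalar fun i j => (Z i 0 0)ᴴ * diagonal d₁ * Z j 1 0 + (Z i 0 1)ᴴ * diagonal d₁ * Z j 1 1
  diag_upper :
    IsScalar fun i j => Z j 0 1 * diagonal d₂ * (Z i 0 0)ᴴ + Z j 1 1 * diagonal d₂ * (Z i 1 0)ᴴ

lemma isScalar_matrix {m n : Type*} {X : Fin 2 → Fin 2 → Matrix m n ℂ}
    (h : ∀ a b, IsScalar fun i j => X i j a b) : IsScalar X := by
  simp only [isScalar_iff] at h ⊢
  exact ⟨by ext a b; exact (h a b).1, by ext a b; exact (h a b).2.1,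
    by ext a b; exact (h a b).2.2⟩

/-- The blocks of a vector of `ℂ⁴ ⊗ ℂ⁴`. -/
def block (φ : Fin 4 × Fin 4 → ℂ) (s t : Fin 2) : Matrix (Fin 2) (Fin 2) ℂ :=
  of fun x y => φ (idx s x, idx t y)

lemma blockCode_of_isScalar {θ₁ θ₂ : ℝ} {φ : Fin 2 → Fin 4 × Fin 4 → ℂ}
    (h : ∀ A ∈ graphSpace θ₁, ∀ B ∈ graphSpace θ₂,
      IsScalar fun i j => sesq (kronecker A B) (φ i) (φ j)) :
    BlockCode (phases θ₁) (phases θ₂) fun i => block (φ i) where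
  inner x y x' y' := by
    have := h _ (diagBlock_mem θ₁ (single x x' 1)) _ (diagBlock_mem θ₂ (single y y' 1))
    simp only [sesq_kronecker, sum_diagBlock_single] at this
    exact this
  upper_upper := by
    have := h _ (upperBlock_mem θ₁) _ (upperBlock_mem θ₂)
    simp only [sesq_kronecker, sum_upperBlock] at this
    convert this using 3
    simp [trace, mul_apply, Fin.sum_univ_two, block, diagonal_apply]
    ring
  upper_lower := by
    have := h _ (upperBlock_mem θ₁) _ (lowerBlock_mem θ₂)
    simp only [sesq_kronecker, sum_upperBlock, sum_lowerBlock] at this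
    convert this using 3
    simp [trace, mul_apply, Fin.sum_univ_two, block, diagonal_apply]
    ring
  upper_diag := isScalar_matrix fun y y' => by
    have := h _ (upperBlock_mem θ₁) _ (diagBlock_mem θ₂ (single y y' 1))
    simp only [sesq_kronecker, sum_upperBlock, sum_diagBlock_single] at this
    convert this using 3
    simp [mul_apply, Fin.sum_univ_two, block, diagonal_apply]
    ring
  diag_upper := isScalar_matrix fun x' x => by
    have := h _ (diagBlock_mem θ₁ (single x x' 1)) _ (upperBlock_mem θ₂)
    simp only [sesq_kronecker, sum_upperBlock, sum_diagBlock_single] at this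
    convert this using 3
    simp [mul_apply, Fin.sum_univ_two, block, diagonal_apply]
    ring

lemma idx_surjective (a : Fin 4) : ∃ s x, idx s x = a := by
  fin_cases a
  exacts [⟨0, 0, rfl⟩, ⟨0, 1, rfl⟩, ⟨1, 0, rfl⟩, ⟨1, 1, rfl⟩]

lemma exists_block_ne_zero {φ : Fin 4 × Fin 4 → ℂ} (h : φ ≠ 0) : ∃ s t, block φ s t ≠ 0 := by
  contrapose! h
  ext ⟨a, b⟩
  obtain ⟨s, x, rfl⟩ := idx_surjective a
  obtain ⟨t, y, rfl⟩ := idx_surjective b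
  exact congrFun (congrFun (h s t) x) y

/-! ### Simultaneous singular value decomposition -/

section Decomposition

lemma star_dotProduct_self_eq_zero {ι : Type*} [Fintype ι] {x : ι → ℂ} :
    star x ⬝ᵥ x = 0 ↔ x = 0 := by
  rw [dotProduct_comm, dotProduct_self_star_eq_zero]

lemma perp_comm {ι : Type*} [Fintype ι] {x y : ι → ℂ} (h : star x ⬝ᵥ y = 0) :
    star y ⬝ᵥ x = 0 := by
  rw [star_dotProduct, h, star_zero]


variable {m n : Type*} [Fintype m] [Fintype n]

lemma star_mulVec_dotProduct_mulVec (F G : Matrix m n ℂ) (x y : n → ℂ) :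
    star (F *ᵥ x) ⬝ᵥ (G *ᵥ y) = star x ⬝ᵥ ((Fᴴ * G) *ᵥ y) := by
  rw [star_mulVec, ← mulVec_mulVec, dotProduct_mulVec, dotProduct_mulVec]
  simp [vecMul_vecMul, dotProduct_mulVec]

/-- Two matrices with equal Gram matrices and orthogonal ranges have singular value
decompositions which differ only in their left factors. -/
lemma exists_common_decomposition (F G : Matrix m n ℂ) (h0 : Fᴴ * G = 0)
    (h1 : Fᴴ * F = Gᴴ * G) :
    ∃ (r : ℕ) (u v : Fin r → m → ℂ) (w : Fin r → n → ℂ),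
      (∀ a b, star (u a) ⬝ᵥ u b = if a = b then 1 else 0) ∧
      (∀ a b, star (v a) ⬝ᵥ v b = if a = b then 1 else 0) ∧
      (∀ a b, star (u a) ⬝ᵥ v b = 0) ∧
      (∀ k j, F k j = ∑ a, u a k * w a j) ∧
      (∀ k j, G k j = ∑ a, v a k * w a j) ∧
      LinearIndependent ℂ w := by
  classical
  let L : (n → ℂ) →ₗ[ℂ] EuclideanSpace ℂ m :=
    (WithLp.linearEquiv 2 ℂ (m → ℂ)).symm.toLinearMap ∘ₗ F.mulVecLin
  have hL : ∀ x, (L x).ofLp = F *ᵥ x := fun x => rfl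
  let b := stdOrthonormalBasis ℂ (LinearMap.range L)
  choose x hx using fun a => (b a).2
  have hon : ∀ a c, star (F *ᵥ x a) ⬝ᵥ (F *ᵥ x c) = if a = c then 1 else 0 := by
    intro a c
    have := orthonormal_iff_ite.1 b.orthonormal a c
    rw [Submodule.coe_inner, ← hx, ← hx, EuclideanSpace.inner_eq_star_dotProduct,
      dotProduct_comm] at this
    exact this
  have hexp : ∀ y, F *ᵥ y = ∑ a, (star (F *ᵥ x a) ⬝ᵥ (F *ᵥ y)) • (F *ᵥ x a) := by
    intro y
    have := b.sum_repr ⟨L y, y, rfl⟩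
    have := congrArg (fun z : LinearMap.range L => (z : EuclideanSpace ℂ m).ofLp) this
    simp only [b.repr_apply_apply, Submodule.coe_inner, AddSubmonoidClass.coe_finsetSum,
      Submodule.coe_smul, ← hx, EuclideanSpace.inner_eq_star_dotProduct] at this
    simp only [WithLp.ofLp_sum, WithLp.ofLp_smul, hL] at this
    simp only [dotProduct_comm (star _)]
    exact this.symm
  have hGF : ∀ y z, star (G *ᵥ y) ⬝ᵥ (G *ᵥ z) = star (F *ᵥ y) ⬝ᵥ (F *ᵥ z) := by
    intro y z
    rw [star_mulVec_dotProduct_mulVec, star_mulVec_dotProduct_mulVec, h1]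
  -- Equal Gram matrices give `F` and `G` the same kernel, so the expansion of `F y` carries over to
  -- `G y` with the same coefficients.
  have hexpG : ∀ y, G *ᵥ y = ∑ a, (star (F *ᵥ x a) ⬝ᵥ (F *ᵥ y)) • (G *ᵥ x a) := by
    intro y
    have hz : F *ᵥ (y - ∑ a, (star (F *ᵥ x a) ⬝ᵥ (F *ᵥ y)) • x a) = 0 := by
      rw [mulVec_sub, mulVec_sum, sub_eq_zero]
      simp only [mulVec_smul]
      exact hexp y
    have hz' : G *ᵥ (y - ∑ a, (star (F *ᵥ x a) ⬝ᵥ (F *ᵥ y)) • x a) = 0 := by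
      rw [← star_dotProduct_self_eq_zero, hGF, hz]
      simp
    rw [mulVec_sub, mulVec_sum, sub_eq_zero] at hz'
    simpa only [mulVec_smul] using hz'
  have hcol : ∀ (X : Matrix m n ℂ) k j, X k j = (X *ᵥ Pi.single j 1) k := by
    intro X k j
    simp
  -- Here `w a` is the functional `y ↦ ⟨F x_a, F y⟩`. The `w a` are independent because they are
  -- dual to the `x c`.
  refine ⟨_, fun a => F *ᵥ x a, fun a => G *ᵥ x a,
    fun a j => star (F *ᵥ x a) ⬝ᵥ (F *ᵥ Pi.single j 1), hon, fun a c => by rw [hGF, hon],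
    fun a c => by rw [star_mulVec_dotProduct_mulVec, h0]; simp, ?_, ?_, ?_⟩
  · intro k j
    rw [hcol F, hexp]
    simp only [Finset.sum_apply, Pi.smul_apply, smul_eq_mul, mul_comm]
  · intro k j
    rw [hcol G, hexpG]
    simp only [Finset.sum_apply, Pi.smul_apply, smul_eq_mul, mul_comm]
  · rw [Fintype.linearIndependent_iff]
    intro g hg c
    have hw : ∀ a y, (fun j => star (F *ᵥ x a) ⬝ᵥ (F *ᵥ Pi.single j 1)) ⬝ᵥ y =
        star (F *ᵥ x a) ⬝ᵥ (F *ᵥ y) := by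
      intro a y
      rw [dotProduct_mulVec]
      congr 1
      ext j
      rw [dotProduct_mulVec]
      simp
    have := congrArg (fun f => f ⬝ᵥ x c) hg
    simp only [sum_dotProduct, smul_dotProduct, hw, hon, zero_dotProduct] at this
    simpa using this

/-- The columns `u`, `v` of `exists_common_decomposition` form an isometry. -/
lemma isometry_of_orthonormal {r : ℕ} {u v : Fin r → m → ℂ}
    (hu : ∀ a b, star (u a) ⬝ᵥ u b = if a = b then 1 else 0)
    (hv : ∀ a b, star (v a) ⬝ᵥ v b = if a = b then 1 else 0)
    (huv : ∀ a b, star (u a) ⬝ᵥ v b = 0) :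
    (of fun k (a : Fin r ⊕ Fin r) => Sum.elim u v a k)ᴴ *
      (of fun k (a : Fin r ⊕ Fin r) => Sum.elim u v a k) = 1 := by
  have hvu : ∀ a b, star (v a) ⬝ᵥ u b = 0 :=
    fun a b => perp_comm (huv b a)
  ext a b
  have key : ∀ x y : Fin r ⊕ Fin r, ((of fun k (a : Fin r ⊕ Fin r) => Sum.elim u v a k)ᴴ *
      (of fun k (a : Fin r ⊕ Fin r) => Sum.elim u v a k)) x y =
      star (Sum.elim u v x) ⬝ᵥ Sum.elim u v y := fun x y => by
    simp [mul_apply, dotProduct]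
  rw [key]
  rcases a with a | a <;> rcases b with b | b <;> simp [hu, hv, huv, hvu, one_apply]

end Decomposition

/-! ### Positivity for accretive diagonals -/

section Diagonal

variable {d e : Fin 2 → ℂ} {A : Matrix (Fin 2) (Fin 2) ℂ}

/-- The trace is `∑ |A x y|² d x e y`, a nonnegative combination of numbers with positive real part.
-/
lemma re_trace_pos (h : ∀ x y, 0 < (d x * e y).re) (hA : A ≠ 0) :
    0 < (Aᴴ * diagonal d * A * diagonal e).trace.re := by
  have key : (Aᴴ * diagonal d * A * diagonal e).trace.re =
      ∑ x, ∑ y, Complex.normSq (A x y) * (d x * e y).re := by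
    simp [trace, mul_apply, Fin.sum_univ_two, diagonal_apply, Complex.normSq_apply]
    ring
  rw [key]
  obtain ⟨x, y, hxy⟩ : ∃ x y, A x y ≠ 0 := by
    contrapose! hA
    ext x y
    exact hA x y
  have hnn : ∀ x y, 0 ≤ Complex.normSq (A x y) * (d x * e y).re := fun x y =>
    mul_nonneg (Complex.normSq_nonneg _) (h x y).le
  refine Finset.sum_pos' (fun x _ => Finset.sum_nonneg fun y _ => hnn x y) ⟨x, Finset.mem_univ _, ?_⟩
  exact Finset.sum_pos' (fun y _ => hnn x y) ⟨y, Finset.mem_univ _,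
    mul_pos (Complex.normSq_pos.2 hxy) (h x y)⟩

lemma re_trace_left_pos (h : ∀ x, 0 < (d x).re) (hA : A ≠ 0) :
    0 < (Aᴴ * diagonal d * A).trace.re := by
  simpa using re_trace_pos (d := d) (e := 1) (by simpa using h) hA

lemma re_trace_right_pos (h : ∀ x, 0 < (d x).re) (hA : A ≠ 0) :
    0 < (A * diagonal d * Aᴴ).trace.re := by
  simpa using re_trace_left_pos h (conjTranspose_eq_zero.not.2 hA)

lemma eq_zero_of_left (h : ∀ x, 0 < (d x).re) (hA : Aᴴ * diagonal d * A = 0) : A = 0 := by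
  by_contra hne
  simpa [hA] using re_trace_left_pos h hne

lemma eq_zero_of_right (h : ∀ x, 0 < (d x).re) (hA : A * diagonal d * Aᴴ = 0) : A = 0 := by
  by_contra hne
  simpa [hA] using re_trace_right_pos h hne

/-- With `G = (d A)† A`, multiplying the hypothesis on the left by `(d A)†` gives `G e G† = 0`.
Hence `G = 0`, that is `A† d A = 0`, and so `A = 0`. -/
lemma eq_zero_of_sandwich (hd : ∀ x, 0 < (d x).re) (he : ∀ x, 0 < (e x).re)
    (h : A * diagonal e * Aᴴ * diagonal d * A = 0) : A = 0 := by
  have h1 : ((diagonal d * A)ᴴ * A) * diagonal e * ((diagonal d * A)ᴴ * A)ᴴ = 0 := by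
    calc _ = (diagonal d * A)ᴴ * (A * diagonal e * Aᴴ * diagonal d * A) := by
          simp only [conjTranspose_mul, conjTranspose_conjTranspose, Matrix.mul_assoc]
      _ = 0 := by rw [h, Matrix.mul_zero]
  have h2 := congrArg conjTranspose (eq_zero_of_right he h1)
  refine eq_zero_of_left hd ?_
  simpa [Matrix.mul_assoc] using h2

end Diagonal

/-! ### Orthogonality and singular matrices in dimension two -/

section Planar

lemma exists_smul_of_perp {p x y : Fin 2 → ℂ} (hp : p ≠ 0) (hx : x ≠ 0)
    (h1 : star p ⬝ᵥ x = 0) (h2 : star p ⬝ᵥ y = 0) : ∃ κ : ℂ, y = κ • x := by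
  simp only [dotProduct, Fin.sum_univ_two, Pi.star_apply] at h1 h2
  have hc : x 0 * y 1 = x 1 * y 0 := by
    have hp' : p 0 ≠ 0 ∨ p 1 ≠ 0 := by
      by_contra! h
      exact hp (by ext i; fin_cases i <;> simp [h])
    rcases hp' with h | h
    · apply mul_left_cancel₀ (star_ne_zero.2 h)
      linear_combination y 1 * h1 - x 1 * h2
    · apply mul_left_cancel₀ (star_ne_zero.2 h)
      linear_combination x 0 * h2 - y 0 * h1
  have hx' : x 0 ≠ 0 ∨ x 1 ≠ 0 := by
    by_contra! h
    exact hx (by ext i; fin_cases i <;> simp [h])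
  rcases hx' with h | h
  · refine ⟨y 0 / x 0, ?_⟩
    ext i
    fin_cases i
    · simp [h]
    · simp; field_simp; linear_combination hc
  · refine ⟨y 1 / x 1, ?_⟩
    ext i
    fin_cases i
    · simp; field_simp; linear_combination -hc
    · simp [h]

/-- Four product vectors of `ℂ² ⊗ ℂ²` which are pairwise orthogonal, one of them being orthogonal
to two others in the second factor. -/
lemma parallel_of_perp {ax ay az mp mx my mz : Fin 2 → ℂ}
    (hax : ax ≠ 0) (hay : ay ≠ 0) (haz : az ≠ 0)
    (hmp : mp ≠ 0) (hmx : mx ≠ 0) (hmy : my ≠ 0)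
    (hxy : star ax ⬝ᵥ ay = 0 ∨ star mx ⬝ᵥ my = 0)
    (hxz : star ax ⬝ᵥ az = 0 ∨ star mx ⬝ᵥ mz = 0)
    (hyz : star ay ⬝ᵥ az = 0 ∨ star my ⬝ᵥ mz = 0)
    (hpx : star mp ⬝ᵥ mx = 0) (hpy : star mp ⬝ᵥ my = 0) :
    (∃ κ : ℂ, my = κ • mx) ∧ ∃ κ : ℂ, mz = κ • mp := by
  obtain ⟨κ, rfl⟩ := exists_smul_of_perp hmp hmx hpx hpy
  refine ⟨⟨κ, rfl⟩, ?_⟩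
  have hκ : κ ≠ 0 := fun h => hmy (by simp [h])
  rcases hxz with hxz | hxz
  swap
  · exact exists_smul_of_perp hmx hmp (perp_comm hpx) hxz
  rcases hyz with hyz | hyz
  swap
  · exact exists_smul_of_perp hmy hmp (perp_comm hpy) hyz
  -- As `mx` and `my` are parallel, `ax ⊥ ay`; then `ax`, `ay`, `az` would be three nonzero pairwise
  -- orthogonal vectors of a plane.
  exfalso
  have hxy' : star ax ⬝ᵥ ay = 0 := by
    rcases hxy with h | h
    · exact h
    · rw [dotProduct_smul, smul_eq_mul, mul_eq_zero, star_dotProduct_self_eq_zero] at h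
      tauto
  obtain ⟨μ, rfl⟩ := exists_smul_of_perp hax hay hxy' hxz
  rw [dotProduct_smul, smul_eq_mul, mul_eq_zero, star_dotProduct_self_eq_zero] at hyz
  rcases hyz with h | h
  · exact haz (by simp [h])
  · exact hay h

lemma exists_unit {e : Fin 2 → ℂ} (he : e ≠ 0) :
    ∃ (N : ℂ) (e' : Fin 2 → ℂ), N ≠ 0 ∧ e = N • e' ∧ star e' ⬝ᵥ e' = 1 := by
  let E : EuclideanSpace ℂ (Fin 2) := WithLp.toLp 2 e
  have hE : E ≠ 0 := fun h => he (congrArg WithLp.ofLp h)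
  have hN : (‖E‖ : ℂ) ≠ 0 := by exact_mod_cast norm_ne_zero_iff.2 hE
  have hsq : star e ⬝ᵥ e = (‖E‖ : ℂ) ^ 2 := by
    have := inner_self_eq_norm_sq_to_K (𝕜 := ℂ) E
    rw [EuclideanSpace.inner_eq_star_dotProduct, dotProduct_comm] at this
    exact this
  refine ⟨‖E‖, (‖E‖ : ℂ)⁻¹ • e, hN, by rw [smul_smul, mul_inv_cancel₀ hN, one_smul], ?_⟩
  rw [star_smul, smul_dotProduct, dotProduct_smul, hsq]
  simp
  field_simp

lemma expand_orthonormal {x y : Fin 2 → ℂ} (hx : star x ⬝ᵥ x = 1) (hy : star y ⬝ᵥ y = 1)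
    (hxy : star x ⬝ᵥ y = 0) (z : Fin 2 → ℂ) :
    z = (star x ⬝ᵥ z) • x + (star y ⬝ᵥ z) • y := by
  have hyx := perp_comm hxy
  have h1 : (of ![x, y]).map star * (of ![x, y])ᵀ = 1 := by
    ext i j
    fin_cases i <;> fin_cases j <;>
      simp_all [mul_apply, dotProduct, Fin.sum_univ_two]
  have h2 := mul_eq_one_comm.1 h1
  have h3 := congrArg (fun M => M *ᵥ z) h2
  rw [one_mulVec] at h3
  ext i
  have := congrFun h3 i
  fin_cases i <;>
  · simp [mulVec, dotProduct, mul_apply, Fin.sum_univ_two] at this ⊢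
    linear_combination -this

lemma exists_vecMulVec_of_det_eq_zero {z : Matrix (Fin 2) (Fin 2) ℂ} (h : z.det = 0) :
    ∃ a m : Fin 2 → ℂ, z = vecMulVec a m := by
  rw [det_fin_two] at h
  by_cases h0 : z 0 0 = 0 ∧ z 0 1 = 0
  · refine ⟨![0, 1], ![z 1 0, z 1 1], ?_⟩
    ext i j
    fin_cases i <;> fin_cases j <;> simp [vecMulVec_apply, h0]
  · by_cases h00 : z 0 0 = 0
    · have h01 : z 0 1 ≠ 0 := fun h => h0 ⟨h00, h⟩
      refine ⟨![1, z 1 1 / z 0 1], ![z 0 0, z 0 1], ?_⟩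
      ext i j
      fin_cases i <;> fin_cases j <;> simp [vecMulVec_apply]
      · field_simp; linear_combination -h
      · field_simp
    · refine ⟨![1, z 1 0 / z 0 0], ![z 0 0, z 0 1], ?_⟩
      ext i j
      fin_cases i <;> fin_cases j <;> simp [vecMulVec_apply]
      · field_simp
      · field_simp; linear_combination h

/-- If `p† d q` is scalar for orthogonal `p`, `q` and an accretive `d`, then `p`, `q` are
singular and `p† d q = 0`. -/
lemma det_eq_zero_of_isScalar {d p q : Matrix (Fin 2) (Fin 2) ℂ}
    (hd : ∀ c : Fin 2 → ℂ, c ≠ 0 → 0 < (star c ⬝ᵥ (d *ᵥ c)).re) {l : ℂ}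
    (h : pᴴ * d * q = l • (1 : Matrix (Fin 2) (Fin 2) ℂ)) (horth : (pᴴ * q).trace = 0)
    (hp : p ≠ 0) (hq : q ≠ 0) : p.det = 0 ∧ q.det = 0 ∧ l = 0 := by
  have htr : d.trace ≠ 0 := by
    intro h0
    have h1 := hd (Pi.single 0 1) (by simp)
    have h2 := hd (Pi.single 1 1) (by simp)
    have h3 := congrArg Complex.re h0
    simp [trace, Fin.sum_univ_two] at h1 h2 h3
    linarith
  have hdet : IsUnit d.det := by
    rw [isUnit_iff_ne_zero]
    intro h0
    obtain ⟨v, hv, hv0⟩ := exists_mulVec_eq_zero_iff.2 h0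
    simpa [hv0] using hd v hv
  -- If `l ≠ 0`, then `q p† = l d⁻¹`. In dimension two `tr (adj d) = tr d`, so `tr (p† q) = 0` would
  -- force `tr d = 0`, against accretivity.
  have hl : l = 0 := by
    by_contra hl
    have h1 : (l⁻¹ • (pᴴ * d)) * q = 1 := by
      rw [Matrix.smul_mul, h, smul_smul, inv_mul_cancel₀ hl, one_smul]
    have h2 : (q * pᴴ) * d = l • (1 : Matrix (Fin 2) (Fin 2) ℂ) := by
      have h3 := mul_eq_one_comm.1 h1
      rw [Matrix.mul_smul] at h3
      rw [Matrix.mul_assoc, ← h3, smul_smul, mul_inv_cancel₀ hl, one_smul]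
    have h4 := congrArg (fun M => (M * d.adjugate).trace) h2
    simp only [Matrix.mul_assoc, mul_adjugate] at h4
    rw [← Matrix.mul_assoc, Matrix.mul_smul, Matrix.mul_one, trace_smul, trace_mul_comm, horth,
      Matrix.smul_mul, Matrix.one_mul, trace_smul] at h4
    rw [adjugate_fin_two, trace_fin_two] at h4
    simp [hl] at h4
    rw [trace_fin_two] at htr
    exact htr (by linear_combination h4)
  subst hl
  rw [zero_smul] at h
  have hdu : IsUnit d := (isUnit_iff_isUnit_det d).2 hdet
  refine ⟨?_, ?_, rfl⟩
  · by_contra hne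
    have hu : IsUnit (pᴴ * d) := by
      rw [isUnit_iff_isUnit_det, det_mul, det_conjTranspose]
      exact (isUnit_iff_ne_zero.2 (star_ne_zero.2 hne)).mul hdet
    exact hq ((hu.mul_right_eq_zero).1 h)
  · by_contra hne
    have hu : IsUnit (d * q) := by
      rw [isUnit_iff_isUnit_det, det_mul]
      exact hdet.mul (isUnit_iff_ne_zero.2 hne)
    rw [Matrix.mul_assoc] at h
    exact hp (conjTranspose_eq_zero.1 ((hu.mul_left_eq_zero).1 h))

end Planar

/-! ### Product codes -/

/-- Positivity of the real parts of the phases and of their products. -/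
structure Accretive (d₁ d₂ : Fin 2 → ℂ) : Prop where
  left : ∀ x, 0 < (d₁ x).re
  right : ∀ x, 0 < (d₂ x).re
  mul : ∀ x y, 0 < (d₁ x * d₂ y).re
  mul_star : ∀ x y, 0 < (d₁ x * star d₂ y).re

lemma Accretive.swap {d₁ d₂ : Fin 2 → ℂ} (h : Accretive d₁ d₂) : Accretive d₂ d₁ where
  left := h.right
  right := h.left
  mul x y := by rw [mul_comm]; exact h.mul y x
  mul_star x y := by
    have := h.mul_star y x
    simp only [Pi.star_apply, Complex.star_def, Complex.mul_re, Complex.conj_re,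
      Complex.conj_im] at this ⊢
    linarith

/-- The combination of the matrices `W` with coefficients `a`. -/
def comb (W : Fin 2 → Matrix (Fin 2) (Fin 2) ℂ) (a : Fin 2 → ℂ) : Matrix (Fin 2) (Fin 2) ℂ :=
  a 0 • W 0 + a 1 • W 1

lemma comb_smul (W : Fin 2 → Matrix (Fin 2) (Fin 2) ℂ) (c : ℂ) (a : Fin 2 → ℂ) :
    comb W (c • a) = c • comb W a := by
  simp [comb, smul_smul]

lemma comb_add (W : Fin 2 → Matrix (Fin 2) (Fin 2) ℂ) (a b : Fin 2 → ℂ) :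
    comb W (a + b) = comb W a + comb W b := by
  simp only [comb, Pi.add_apply]
  module

lemma comb_transpose (W : Fin 2 → Matrix (Fin 2) (Fin 2) ℂ) (a : Fin 2 → ℂ) :
    comb (fun c => (W c)ᵀ) a = (comb W a)ᵀ := by
  simp [comb]

/-- Knill–Laflamme conditions for vectors whose blocks are `m s t i • comb W (a s t)`. -/
structure ProductCode (d₁ d₂ : Fin 2 → ℂ) (W : Fin 2 → Matrix (Fin 2) (Fin 2) ℂ)
    (a m : Fin 2 → Fin 2 → Fin 2 → ℂ) : Prop where
  indep : ∀ c : Fin 2 → ℂ, comb W c = 0 → c = 0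
  norm : ∀ s t, (star (a s t) ⬝ᵥ a s t) * (star (m s t) ⬝ᵥ m s t) = 1
  orth : ∀ s t s' t', (s, t) ≠ (s', t') →
    (star (a s t) ⬝ᵥ a s' t') * (star (m s t) ⬝ᵥ m s' t') = 0
  upper_upper :
    ((comb W (a 0 0))ᴴ * diagonal d₁ * comb W (a 1 1) * diagonal d₂).trace = 0
  upper_diag : IsScalar fun i j =>
    (star (m 0 0 i) * m 1 0 j) • ((comb W (a 0 0))ᴴ * diagonal d₁ * comb W (a 1 0)) +
    (star (m 0 1 i) * m 1 1 j) • ((comb W (a 0 1))ᴴ * diagonal d₁ * comb W (a 1 1))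
  diag_upper : IsScalar fun i j =>
    (star (m 0 0 i) * m 0 1 j) • (comb W (a 0 1) * diagonal d₂ * (comb W (a 0 0))ᴴ) +
    (star (m 1 0 i) * m 1 1 j) • (comb W (a 1 1) * diagonal d₂ * (comb W (a 1 0))ᴴ)

/-- Frees the condition from the standard basis, so that it can be tested on a basis adapted to the
vectors `m s t`. The slot `y` is bilinear, hence the conjugated vectors inserted there later. -/
lemma IsScalar.contract {V : Type*} [AddCommGroup V] [Module ℂ V] {e f e' f' : Fin 2 → ℂ}
    {U U' : V} (h : IsScalar fun i j => (star (e i) * f j) • U + (star (e' i) * f' j) • U') :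
    ∃ Λ : V, ∀ x y : Fin 2 → ℂ, ((star e ⬝ᵥ x) * (y ⬝ᵥ f)) • U +
      ((star e' ⬝ᵥ x) * (y ⬝ᵥ f')) • U' = (y ⬝ᵥ x) • Λ := by
  obtain ⟨Λ, h⟩ := h
  refine ⟨Λ, fun x y => ?_⟩
  have h00 := h 0 0
  have h01 := h 0 1
  have h10 := h 1 0
  have h11 := h 1 1
  simp only [if_true, Fin.zero_eq_one_iff, Fin.one_eq_zero_iff, OfNat.ofNat_ne_one,
    if_false] at h00 h01 h10 h11
  simp only [dotProduct, Fin.sum_univ_two, Pi.star_apply]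
  linear_combination (norm := module) (x 0 * y 0) • h00 + (x 0 * y 1) • h01 +
    (x 1 * y 0) • h10 + (x 1 * y 1) • h11

namespace ProductCode

variable {d₁ d₂ : Fin 2 → ℂ} {W : Fin 2 → Matrix (Fin 2) (Fin 2) ℂ}
  {a m : Fin 2 → Fin 2 → Fin 2 → ℂ}

lemma a_ne_zero (h : ProductCode d₁ d₂ W a m) (s t : Fin 2) : a s t ≠ 0 := by
  intro h0
  simpa [h0] using h.norm s t

lemma m_ne_zero (h : ProductCode d₁ d₂ W a m) (s t : Fin 2) : m s t ≠ 0 := by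
  intro h0
  simpa [h0] using h.norm s t

lemma comb_ne_zero (h : ProductCode d₁ d₂ W a m) (s t : Fin 2) : comb W (a s t) ≠ 0 :=
  fun h0 => h.a_ne_zero s t (h.indep _ h0)

lemma perp (h : ProductCode d₁ d₂ W a m) {s t s' t' : Fin 2} (hne : (s, t) ≠ (s', t')) :
    star (a s t) ⬝ᵥ a s' t' = 0 ∨ star (m s t) ⬝ᵥ m s' t' = 0 :=
  mul_eq_zero.1 (h.orth s t s' t' hne)

/-- Exchange of the two parties. -/
lemma swap (h : ProductCode d₁ d₂ W a m) :
    ProductCode d₂ d₁ (fun c => (W c)ᵀ) (fun s t => a t s) (fun s t => m t s) where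
  indep c hc := h.indep c (by
    rw [comb_transpose] at hc
    exact transpose_eq_zero.1 hc)
  norm s t := h.norm t s
  orth s t s' t' hne := h.orth t s t' s' (by
    simp only [ne_eq, Prod.mk.injEq] at hne ⊢
    exact fun h' => hne ⟨h'.2, h'.1⟩)
  upper_upper := by
    have := h.upper_upper
    rw [← trace_transpose] at this
    simp only [comb_transpose, transpose_mul, diagonal_transpose] at this ⊢
    rw [← this, Matrix.mul_assoc, Matrix.mul_assoc, trace_mul_comm]
    simp only [Matrix.mul_assoc]
    rfl
  upper_diag := by
    obtain ⟨Λ, hΛ⟩ := h.diag_upper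
    refine ⟨Λᵀ, fun i j => ?_⟩
    have := congrArg transpose (hΛ i j)
    simp only [comb_transpose, transpose_mul, diagonal_transpose, transpose_add,
      transpose_smul] at this ⊢
    rw [apply_ite transpose, transpose_zero] at this
    rw [← this]
    simp only [Matrix.mul_assoc]
    rfl
  diag_upper := by
    obtain ⟨Λ, hΛ⟩ := h.upper_diag
    refine ⟨Λᵀ, fun i j => ?_⟩
    have := congrArg transpose (hΛ i j)
    simp only [comb_transpose, transpose_mul, diagonal_transpose, transpose_add,
      transpose_smul] at this ⊢
    rw [apply_ite transpose, transpose_zero] at this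
    rw [← this]
    simp only [Matrix.mul_assoc]
    rfl

/-- Moving scalars between the two factors of the product vectors. -/
lemma rescale (h : ProductCode d₁ d₂ W a m) {a' m' : Fin 2 → Fin 2 → Fin 2 → ℂ}
    {κ : Fin 2 → Fin 2 → ℂ} (ha : ∀ s t, a' s t = κ s t • a s t)
    (hm : ∀ s t, m s t = κ s t • m' s t) : ProductCode d₁ d₂ W a' m' where
  indep := h.indep
  norm s t := by
    rw [← h.norm s t, ha, hm]
    simp only [star_smul, smul_dotProduct, dotProduct_smul, smul_eq_mul]
    ring
  orth s t s' t' hne := by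
    rw [← h.orth s t s' t' hne, ha, ha, hm s t, hm s' t']
    simp only [star_smul, smul_dotProduct, dotProduct_smul, smul_eq_mul]
    ring
  upper_upper := by
    simp only [ha, comb_smul, conjTranspose_smul, Matrix.smul_mul, Matrix.mul_smul, trace_smul,
      h.upper_upper, smul_zero]
  upper_diag := by
    convert h.upper_diag using 3
    simp only [ha, hm, comb_smul, conjTranspose_smul, Matrix.smul_mul, Matrix.mul_smul, smul_smul,
      Pi.smul_apply, smul_eq_mul, star_mul']
    congr 2 <;> ring
  diag_upper := by
    convert h.diag_upper using 3
    simp only [ha, hm, comb_smul, conjTranspose_smul, Matrix.smul_mul, Matrix.mul_smul, smul_smul,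
      Pi.smul_apply, smul_eq_mul, star_mul']
    congr 2 <;> ring

lemma normalize_right (h : ProductCode d₁ d₂ W a m) (g : Fin 2 → Fin 2 → Fin 2)
    {e : Fin 2 → Fin 2 → ℂ} (he : ∀ j, e j ≠ 0) (hperp : star (e 0) ⬝ᵥ e 1 = 0)
    (hm : ∀ s t, ∃ κ : ℂ, m s t = κ • e (g s t)) :
    ∃ (a' : Fin 2 → Fin 2 → Fin 2 → ℂ) (e' : Fin 2 → Fin 2 → ℂ),
      ProductCode d₁ d₂ W a' (fun s t => e' (g s t)) ∧ (∀ j, star (e' j) ⬝ᵥ e' j = 1) ∧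
      star (e' 0) ⬝ᵥ e' 1 = 0 := by
  choose κ hκ using hm
  choose N e' hN he' hu using fun j => exists_unit (he j)
  refine ⟨fun s t => (κ s t * N (g s t)) • a s t, e',
    h.rescale (κ := fun s t => κ s t * N (g s t)) (fun _ _ => rfl)
      (fun s t => by rw [hκ, he', smul_smul]), hu, ?_⟩
  rw [he' 0, he' 1, star_smul, smul_dotProduct, dotProduct_smul] at hperp
  simpa [hN] using hperp

lemma normalize_left (h : ProductCode d₁ d₂ W a m) (g : Fin 2 → Fin 2 → Fin 2)
    {e : Fin 2 → Fin 2 → ℂ} (he : ∀ j, e j ≠ 0) (ha : ∀ s t, ∃ κ : ℂ, a s t = κ • e (g s t)) :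
    ∃ (m' : Fin 2 → Fin 2 → Fin 2 → ℂ) (e' : Fin 2 → Fin 2 → ℂ),
      ProductCode d₁ d₂ W (fun s t => e' (g s t)) m' ∧ ∀ j, star (e' j) ⬝ᵥ e' j = 1 := by
  choose κ hκ using ha
  choose N e' hN he' hu using fun j => exists_unit (he j)
  have hκ0 : ∀ s t, κ s t ≠ 0 := fun s t h0 => h.a_ne_zero s t (by simp [hκ, h0])
  refine ⟨fun s t => (κ s t * N (g s t)) • m s t, e',
    h.rescale (κ := fun s t => (κ s t * N (g s t))⁻¹) (fun s t => ?_) (fun s t => ?_), hu⟩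
  · rw [hκ, he', smul_smul, smul_smul, mul_assoc, inv_mul_cancel₀ (mul_ne_zero (hκ0 s t) (hN _)), one_smul]
  · rw [smul_smul, inv_mul_cancel₀ (mul_ne_zero (hκ0 s t) (hN _)), one_smul]

end ProductCode

/-- Two singular matrices with common kernels are proportional. -/
lemma mul_eq_mul_of_common_kernel {A B : Matrix (Fin 2) (Fin 2) ℂ} (hA : A.det = 0)
    (hA0 : A ≠ 0) (hr : ∀ Y : Matrix (Fin 2) (Fin 2) ℂ, A * Y = 0 → B * Y = 0)
    (hl : ∀ X : Matrix (Fin 2) (Fin 2) ℂ, X * A = 0 → X * B = 0) : ∃ κ : ℂ, B = κ • A := by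
  obtain ⟨x, y, rfl⟩ := exists_vecMulVec_of_det_eq_zero hA
  -- For `A = x yᵀ`, the vectors `(-y₁, y₀)` and `(-x₁, x₀)` span the right and left kernels.
  have h1 : B * of ![![-y 1, 0], ![y 0, 0]] = 0 := hr _ (by
    ext i j
    fin_cases j <;> simp [mul_apply, Fin.sum_univ_two, vecMulVec_apply]
    ring)
  have h2 : of ![![-x 1, x 0], ![0, 0]] * B = 0 := hl _ (by
    ext i j
    fin_cases i <;> simp [mul_apply, Fin.sum_univ_two, vecMulVec_apply]
    ring)
  have h1' : ∀ c c' c₀, y c' * B c c₀ = y c₀ * B c c' := by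
    intro c c' c₀
    have := congrFun (congrFun h1 c) 0
    simp [mul_apply, Fin.sum_univ_two] at this
    fin_cases c' <;> fin_cases c₀ <;> simp
    · linear_combination this
    · linear_combination -this
  have h2' : ∀ c c₀ c', x c * B c₀ c' = x c₀ * B c c' := by
    intro c c₀ c'
    have := congrFun (congrFun h2 0) c'
    simp [mul_apply, Fin.sum_univ_two] at this
    fin_cases c <;> fin_cases c₀ <;> simp
    · linear_combination this
    · linear_combination -this
  obtain ⟨c₀, c₀', hne⟩ : ∃ c c', vecMulVec x y c c' ≠ 0 := by
    contrapose! hA0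
    ext c c'
    exact hA0 c c'
  refine ⟨B c₀ c₀' / vecMulVec x y c₀ c₀', ?_⟩
  ext c c'
  rw [Matrix.smul_apply, smul_eq_mul, div_mul_eq_mul_div, eq_div_iff hne, vecMulVec_apply,
    vecMulVec_apply]
  linear_combination (-y c') * h2' c c₀ c₀' - x c₀ * h1' c c' c₀'

namespace ProductCode

variable {d₁ d₂ : Fin 2 → ℂ} {W : Fin 2 → Matrix (Fin 2) (Fin 2) ℂ}
  {a m : Fin 2 → Fin 2 → Fin 2 → ℂ}

/-- Otherwise `upper_upper` would be a nonzero multiple of `tr (P† d₁ P d₂)` with `P ≠ 0`. -/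
lemma left_not_parallel (hd : Accretive d₁ d₂) (h : ProductCode d₁ d₂ W a m) {κ : ℂ}
    (hκ : a 1 1 = κ • a 0 0) : False := by
  have hu := h.upper_upper
  rw [hκ, comb_smul, Matrix.mul_smul, Matrix.smul_mul, trace_smul, smul_eq_mul,
    mul_eq_zero] at hu
  rcases hu with rfl | hu
  · exact h.a_ne_zero 1 1 (by rw [hκ, zero_smul])
  · simpa [hu] using re_trace_pos hd.mul (h.comb_ne_zero 0 0)

/-- Write `P, R, T, Q` for the combinations at `00, 01, 10, 11`. Contraction yields `P† d₁ T = R† d₁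
Q = 0` and `R d₂ P† = Q d₂ T† = 0`. Expanding `T` and `R` in `P` and `Q`, positivity makes both
`Q`-coefficients nonzero. Then `P` is singular and `Q` vanishes on both kernels of `P`, so `Q` is a
multiple of `P`, contrary to `left_not_parallel`. -/
lemma false_of_right_diagonal (hd : Accretive d₁ d₂) {e : Fin 2 → Fin 2 → ℂ}
    (h : ProductCode d₁ d₂ W a (fun s t => e (s + t)))
    (hu : ∀ j, star (e j) ⬝ᵥ e j = 1) (h01 : star (e 0) ⬝ᵥ e 1 = 0) : False := by
  have h10 := perp_comm h01
  have hx0 : e 0 ⬝ᵥ star (e 0) = 1 := by rw [dotProduct_comm, hu]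
  have hx1 : e 1 ⬝ᵥ star (e 1) = 1 := by rw [dotProduct_comm, hu]
  obtain ⟨Λ, hU⟩ := h.upper_diag.contract
  obtain ⟨Λ', hV⟩ := h.diag_upper.contract
  have s11 : (1 : Fin 2) + 1 = 0 := rfl
  simp only [add_zero, zero_add, s11] at hU hV
  have U1 := hU (e 0) (star (e 1))
  have U2 := hU (e 1) (star (e 0))
  have V1 := hV (e 0) (star (e 1))
  have V2 := hV (e 1) (star (e 0))
  simp only [hu, h01, h10, mul_one, mul_zero, one_smul, zero_smul, add_zero, zero_add]
    at U1 U2 V1 V2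
  have n0 := h.norm 0 0
  have n1 := h.norm 1 1
  have o := h.orth 0 0 1 1 (by simp)
  simp only [add_zero, s11, hu, mul_one] at n0 n1 o
  have ht := expand_orthonormal n0 n1 o (a 1 0)
  have hr := expand_orthonormal n0 n1 o (a 0 1)
  have ht0 := h.comb_ne_zero 1 0
  have hr0 := h.comb_ne_zero 0 1
  set τ := star (a 0 0) ⬝ᵥ a 1 0
  set τ' := star (a 1 1) ⬝ᵥ a 1 0
  set σ := star (a 0 0) ⬝ᵥ a 0 1
  set σ' := star (a 1 1) ⬝ᵥ a 0 1
  have ht' : comb W (a 1 0) = τ • comb W (a 0 0) + τ' • comb W (a 1 1) := by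
    rw [ht, comb_add, comb_smul, comb_smul]
  have hr' : comb W (a 0 1) = σ • comb W (a 0 0) + σ' • comb W (a 1 1) := by
    rw [hr, comb_add, comb_smul, comb_smul]
  have hp0 := h.comb_ne_zero 0 0
  have hnp : ¬ ∃ κ : ℂ, comb W (a 1 1) = κ • comb W (a 0 0) := by
    rintro ⟨κ, hκ⟩
    have h1 : comb W (a 1 1 + (-κ) • a 0 0) = 0 := by
      rw [comb_add, comb_smul, hκ]; module
    refine h.left_not_parallel hd (κ := κ) ?_
    linear_combination (norm := module) h.indep _ h1
  generalize comb W (a 0 0) = P at *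
  generalize comb W (a 1 1) = Q at *
  generalize comb W (a 1 0) = T at *
  generalize comb W (a 0 1) = R at *
  have hτ' : τ' ≠ 0 := by
    intro h0
    rw [h0, zero_smul, add_zero] at ht'
    apply ht0
    apply eq_zero_of_left hd.left
    nth_rewrite 1 [ht']
    rw [conjTranspose_smul, Matrix.smul_mul, Matrix.smul_mul, U1, smul_zero]
  have hσ' : σ' ≠ 0 := by
    intro h0
    rw [h0, zero_smul, add_zero] at hr'
    apply hr0
    apply eq_zero_of_right hd.right
    nth_rewrite 2 [hr']
    rw [conjTranspose_smul, Matrix.mul_smul, V1, smul_zero]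
  apply hnp
  refine mul_eq_mul_of_common_kernel ?_ hp0 (fun Y hY => ?_) (fun X hX => ?_)
  · by_contra hdet
    have hunit : IsUnit (Pᴴ * diagonal d₁) := by
      rw [isUnit_iff_isUnit_det, det_mul, det_conjTranspose, det_diagonal, Fin.prod_univ_two]
      refine (isUnit_iff_ne_zero.2 (star_ne_zero.2 hdet)).mul (isUnit_iff_ne_zero.2 ?_)
      refine mul_ne_zero (fun h0 => ?_) (fun h0 => ?_)
      · simpa [h0] using hd.left 0
      · simpa [h0] using hd.left 1
    exact ht0 ((hunit.mul_right_eq_zero).1 U1)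
  · have e1 : Pᴴ * diagonal d₁ * Q * Y = 0 := by
      have := congrArg (· * Y) U1
      simp only [ht', Matrix.mul_add, Matrix.add_mul, Matrix.mul_smul, Matrix.smul_mul,
        Matrix.mul_assoc, hY, Matrix.mul_zero, Matrix.zero_mul, smul_zero, zero_add,
        smul_eq_zero, hτ', false_or] at this
      simpa only [Matrix.mul_assoc] using this
    have e2 : Qᴴ * diagonal d₁ * Q * Y = 0 := by
      have := congrArg (· * Y) U2
      simp only [hr', conjTranspose_add, conjTranspose_smul, Matrix.add_mul,
        Matrix.smul_mul, e1, Matrix.zero_mul, smul_zero, zero_add, smul_eq_zero,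
        star_eq_zero, hσ', false_or] at this
      exact this
    apply eq_zero_of_left hd.left
    rw [conjTranspose_mul]
    calc _ = Yᴴ * (Qᴴ * diagonal d₁ * Q * Y) := by simp only [Matrix.mul_assoc]
      _ = 0 := by rw [e2, Matrix.mul_zero]
  · have e1 : X * (Q * diagonal d₂ * Pᴴ) = 0 := by
      have := congrArg (X * ·) V1
      simp only [hr', Matrix.mul_add, Matrix.add_mul, Matrix.mul_smul, Matrix.smul_mul,
        ← Matrix.mul_assoc, hX, Matrix.mul_zero, Matrix.zero_mul, smul_zero, zero_add,
        smul_eq_zero, hσ', false_or] at this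
      simpa only [Matrix.mul_assoc] using this
    have e2 : X * (Q * diagonal d₂ * Qᴴ) = 0 := by
      have := congrArg (X * ·) V2
      simp only [ht', conjTranspose_add, conjTranspose_smul, Matrix.mul_add,
        Matrix.mul_smul, e1, Matrix.mul_zero, smul_zero, zero_add, smul_eq_zero,
        star_eq_zero, hτ', false_or] at this
      exact this
    apply eq_zero_of_right hd.right
    rw [conjTranspose_mul]
    calc _ = (X * (Q * diagonal d₂ * Qᴴ)) * Xᴴ := by simp only [Matrix.mul_assoc]
      _ = 0 := by rw [e2, Matrix.zero_mul]

end ProductCode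

namespace ProductCode

variable {d₁ d₂ : Fin 2 → ℂ} {W : Fin 2 → Matrix (Fin 2) (Fin 2) ℂ}
  {a m : Fin 2 → Fin 2 → Fin 2 → ℂ}

/-- With the same letters, the conditions read `P† d₁ T + R† d₁ Q = 0` and `R d₂ P† = Q d₂ T†`.
Traces show that `T` is a multiple of `P` and `Q` of `R`; positivity then excludes what remains. -/
lemma false_of_right_rows (hd : Accretive d₁ d₂) {e : Fin 2 → Fin 2 → ℂ}
    (h : ProductCode d₁ d₂ W a (fun s _ => e s))
    (hu : ∀ j, star (e j) ⬝ᵥ e j = 1) (h01 : star (e 0) ⬝ᵥ e 1 = 0) : False := by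
  have h10 := perp_comm h01
  obtain ⟨Λ, hU⟩ := h.upper_diag.contract
  obtain ⟨Λ', hV⟩ := h.diag_upper.contract
  have U1 := hU (e 0) (star (e 1))
  have V1 := hV (e 0) (star (e 0))
  have V2 := hV (e 1) (star (e 1))
  simp only [hu, h01, h10, mul_one, mul_zero, one_smul, zero_smul, add_zero, zero_add]
    at U1 V1 V2
  have V := V1.trans V2.symm
  have n0 := h.norm 0 0
  have n1 := h.norm 0 1
  have o := h.orth 0 0 0 1 (by simp)
  have n2 := h.norm 1 0
  have n3 := h.norm 1 1
  have o' := h.orth 1 0 1 1 (by simp)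
  simp only [hu, mul_one] at n0 n1 o n2 n3 o'
  have o'' := perp_comm o
  have ht := expand_orthonormal n0 n1 o (a 1 0)
  have hq := expand_orthonormal n0 n1 o (a 1 1)
  have hP0 := h.comb_ne_zero 0 0
  have hR0 := h.comb_ne_zero 0 1
  have hup := h.upper_upper
  set v' := star (a 0 0) ⬝ᵥ a 1 0
  set u' := star (a 0 1) ⬝ᵥ a 1 0
  set u := star (a 0 0) ⬝ᵥ a 1 1
  set v := star (a 0 1) ⬝ᵥ a 1 1
  rw [ht] at n2
  rw [hq] at n3
  rw [ht, hq] at o'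
  simp only [star_add, star_smul, add_dotProduct, dotProduct_add, smul_dotProduct,
    dotProduct_smul, n0, n1, o, o'', smul_eq_mul, mul_one, mul_zero, add_zero, zero_add]
    at n2 n3 o'
  have hT : comb W (a 1 0) = v' • comb W (a 0 0) + u' • comb W (a 0 1) := by
    rw [ht, comb_add, comb_smul, comb_smul]
  have hQ : comb W (a 1 1) = u • comb W (a 0 0) + v • comb W (a 0 1) := by
    rw [hq, comb_add, comb_smul, comb_smul]
  rw [hT, hQ] at U1 V
  rw [hQ] at hup
  clear_value u u' v v'
  clear hU hV V1 V2 ht hq hT hQ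
  generalize comb W (a 0 0) = P at *
  generalize comb W (a 0 1) = R at *
  have hpp : (Pᴴ * diagonal d₁ * P * diagonal d₂).trace ≠ 0 := fun h0 => by
    simpa [h0] using re_trace_pos hd.mul hP0
  have e1 : u * (Pᴴ * diagonal d₁ * P * diagonal d₂).trace +
      v * (Pᴴ * diagonal d₁ * R * diagonal d₂).trace = 0 := by
    simpa only [Matrix.mul_add, Matrix.add_mul, Matrix.mul_smul, Matrix.smul_mul, trace_add,
      trace_smul, smul_eq_mul] using hup
  have e2 := congrArg (fun X => (X * diagonal d₂).trace) U1
  have e3 := congrArg (fun X => (X * diagonal d₁).trace) V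
  have c1 : ∀ X Y : Matrix (Fin 2) (Fin 2) ℂ, (Y * diagonal d₂ * Xᴴ * diagonal d₁).trace =
      (Xᴴ * diagonal d₁ * Y * diagonal d₂).trace := by
    intro X Y
    rw [Matrix.mul_assoc, trace_mul_comm, ← Matrix.mul_assoc]
  simp only [Matrix.mul_add, Matrix.add_mul, Matrix.mul_smul, Matrix.smul_mul, trace_add,
    trace_smul, smul_eq_mul, conjTranspose_add, conjTranspose_smul, c1, Matrix.zero_mul,
    trace_zero] at e2 e3
  have hv : v ≠ 0 := by
    rintro rfl
    rw [zero_mul, add_zero, mul_eq_zero] at e1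
    rcases e1 with h0 | h0
    · simp [h0] at n3
    · exact hpp h0
  have e4 : star u' * (Pᴴ * diagonal d₁ * P * diagonal d₂).trace =
      star v' * (Pᴴ * diagonal d₁ * R * diagonal d₂).trace := by
    apply mul_left_cancel₀ hv
    linear_combination (Pᴴ * diagonal d₁ * P * diagonal d₂).trace * o' - star v' * e1
  -- Put `α = tr (P† d₁ P d₂)` and `β = tr (P† d₁ R d₂)`. Eliminating the traces with `R†` from `e2`
  -- and `e3` gives `star v' * β = -(star u' * α)`, while `e4` has the opposite sign.
  have hu' : u' = 0 := by
    have : star u' * (Pᴴ * diagonal d₁ * P * diagonal d₂).trace = 0 := by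
      linear_combination (1 / 2 : ℂ) * ((1 + star u' * u') * e4 + star v' * e3 +
        star v' * star v' * e1 + star v' * star u' * e2
        - star u' * (Pᴴ * diagonal d₁ * P * diagonal d₂).trace * n2)
    rcases mul_eq_zero.1 this with h0 | h0
    · exact star_eq_zero.1 h0
    · exact absurd h0 hpp
  subst hu'
  have hv' : v' ≠ 0 := by
    rintro rfl
    simp at n2
  have hu0 : u = 0 := by simpa [hv'] using o'
  subst hu0
  simp only [zero_smul, add_zero, zero_add, Matrix.mul_smul, conjTranspose_smul,
    Matrix.smul_mul, star_zero, mul_zero] at U1 V n2 n3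
  by_cases hvv : v * star v' = 1
  · have : v = v' := by linear_combination (-v) * n2 + v' * hvv
    subst this
    rw [← smul_add, smul_eq_zero] at U1
    have := congrArg (fun X => X.trace.re) (U1.resolve_left hv)
    simp only [trace_add, Complex.add_re, trace_zero, Complex.zero_re] at this
    have := re_trace_left_pos hd.left hP0
    have := re_trace_left_pos hd.left hR0
    linarith
  · have hz : R * diagonal d₂ * Pᴴ = 0 := by
      have : (1 - v * star v') • (R * diagonal d₂ * Pᴴ) = 0 := by
        rw [sub_smul, one_smul, sub_eq_zero, mul_comm, ← smul_smul]
        exact V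
      exact (smul_eq_zero.1 this).resolve_left (sub_ne_zero.2 (Ne.symm hvv))
    apply hR0
    refine eq_zero_of_sandwich hd.left hd.right ?_
    have := congrArg (R * diagonal d₂ * ·) U1
    simp only [Matrix.mul_add, Matrix.mul_smul, ← Matrix.mul_assoc, hz, Matrix.zero_mul,
      smul_zero, zero_add, Matrix.mul_zero, smul_eq_zero, hv, false_or] at this
    exact this

/-- With `A`, `B` the combinations of the two rows, the conditions become `A d₂ A† + κ̄ κ' B d₂ B† =
0` and `κ A† d₁ B = κ' A† d₁ B`. If `κ = κ'`, the trace of the first is positive; otherwise `A† d₁ B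
= 0` and the first gives `B d₂ B† d₁ B = 0`. -/
lemma false_of_left_rows (hd : Accretive d₁ d₂) {e : Fin 2 → Fin 2 → ℂ}
    (h : ProductCode d₁ d₂ W (fun s _ => e s) m)
    (hu : ∀ j, star (e j) ⬝ᵥ e j = 1) : False := by
  obtain ⟨Λ, hU⟩ := h.upper_diag.contract
  obtain ⟨Λ', hV⟩ := h.diag_upper.contract
  have n0 := h.norm 0 0
  have n1 := h.norm 0 1
  have o := h.orth 0 0 0 1 (by simp)
  have o' := h.orth 1 0 1 1 (by simp)
  simp only [hu, one_mul] at n0 n1 o o'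
  have o'' := perp_comm o
  have hA0 := h.comb_ne_zero 0 0
  have hB0 := h.comb_ne_zero 1 0
  generalize comb W (e 0) = A at *
  generalize comb W (e 1) = B at *
  have hP : A * diagonal d₂ * Aᴴ ≠ 0 := fun h0 => hA0 (eq_zero_of_right hd.right h0)
  -- Summing the diagonal cases `i = j` gives `2 Λ'` on one side and, by orthogonality within each
  -- row of `m`, zero on the other.
  have hΛ' : Λ' = 0 := by
    have h0 := hV (Pi.single 0 1) (Pi.single 0 1)
    have h1 := hV (Pi.single 1 1) (Pi.single 1 1)
    simp only [dotProduct, Fin.sum_univ_two, Pi.star_apply] at o o'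
    simp [dotProduct, Fin.sum_univ_two] at h0 h1
    simp only [Complex.star_def] at o o'
    have : (2 : ℂ) • Λ' = 0 := by
      linear_combination (norm := module) (-1 : ℂ) • h0 - h1 +
        o • (A * diagonal d₂ * Aᴴ) + o' • (B * diagonal d₂ * Bᴴ)
    exact (smul_eq_zero.1 this).resolve_left two_ne_zero
  have V1 := hV (m 0 0) (star (m 0 1))
  have U1 := hU (m 0 0) (star (m 0 0))
  have U2 := hU (m 0 1) (star (m 0 1))
  simp only [n0, n1, o, o'', hΛ', one_mul, mul_one, zero_mul, one_smul, zero_smul,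
    smul_zero, add_zero, zero_add] at V1 U1 U2
  have hκ : star (m 1 0) ⬝ᵥ m 0 0 = star (star (m 0 0) ⬝ᵥ m 1 0) := by
    rw [star_dotProduct]
  rw [hκ] at V1
  generalize star (m 0 0) ⬝ᵥ m 1 0 = κ at *
  generalize star (m 0 1) ⬝ᵥ m 1 1 = κ' at *
  by_cases hκκ : κ = κ'
  · subst hκκ
    have := congrArg (fun X => X.trace.re) V1
    rw [Complex.star_def, ← Complex.normSq_eq_conj_mul_self] at this
    simp only [trace_add, trace_smul, smul_eq_mul, Complex.add_re, Complex.re_ofReal_mul,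
      trace_zero, Complex.zero_re] at this
    have h1 := re_trace_right_pos hd.right hA0
    have h2 := mul_nonneg (Complex.normSq_nonneg κ) (re_trace_right_pos hd.right hB0).le
    linarith
  · have hF : Aᴴ * diagonal d₁ * B = 0 := by
      have : (κ - κ') • (Aᴴ * diagonal d₁ * B) = 0 := by
        rw [sub_smul, U1, U2, sub_self]
      exact (smul_eq_zero.1 this).resolve_left (sub_ne_zero.2 hκκ)
    have hc : star κ * κ' ≠ 0 := by
      intro h0
      rw [h0, zero_smul, add_zero] at V1
      exact hP V1
    apply hB0
    refine eq_zero_of_sandwich hd.left hd.right ?_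
    have := congrArg (· * (diagonal d₁ * B)) V1
    simp only [Matrix.add_mul, Matrix.smul_mul, ← Matrix.mul_assoc, Matrix.zero_mul] at this
    rw [Matrix.mul_assoc, Matrix.mul_assoc, ← Matrix.mul_assoc Aᴴ, hF, Matrix.mul_zero, zero_add,
      smul_eq_zero] at this
    exact this.resolve_left hc

lemma false_of_right_perp_rows (hd : Accretive d₁ d₂) (h : ProductCode d₁ d₂ W a m)
    (h1 : star (m 0 0) ⬝ᵥ m 1 1 = 0) (h2 : star (m 0 0) ⬝ᵥ m 1 0 = 0) : False := by
  obtain ⟨⟨κ, hκ⟩, κ', hκ'⟩ := parallel_of_perp (h.a_ne_zero 1 1) (h.a_ne_zero 1 0)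
    (h.a_ne_zero 0 1) (h.m_ne_zero 0 0) (h.m_ne_zero 1 1) (h.m_ne_zero 1 0)
    (h.perp (by simp)) (h.perp (by simp)) (h.perp (by simp)) h1 h2
  obtain ⟨a', e', h', hu, h01⟩ := h.normalize_right (fun s _ => s) (e := ![m 0 0, m 1 1])
    (by intro j; fin_cases j; exacts [h.m_ne_zero 0 0, h.m_ne_zero 1 1]) h1
    (by
      intro s t
      fin_cases s <;> fin_cases t
      exacts [⟨1, by simp⟩, ⟨κ', by simpa using hκ'⟩, ⟨κ, by simpa using hκ⟩, ⟨1, by simp⟩])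
  exact h'.false_of_right_rows hd hu h01

lemma false_of_right_perp_diagonal (hd : Accretive d₁ d₂) (h : ProductCode d₁ d₂ W a m)
    (h1 : star (m 0 0) ⬝ᵥ m 0 1 = 0) (h2 : star (m 0 0) ⬝ᵥ m 1 0 = 0) : False := by
  obtain ⟨⟨κ, hκ⟩, κ', hκ'⟩ := parallel_of_perp (h.a_ne_zero 0 1) (h.a_ne_zero 1 0)
    (h.a_ne_zero 1 1) (h.m_ne_zero 0 0) (h.m_ne_zero 0 1) (h.m_ne_zero 1 0)
    (h.perp (by simp)) (h.perp (by simp)) (h.perp (by simp)) h1 h2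
  obtain ⟨a', e', h', hu, h01⟩ := h.normalize_right (fun s t => s + t) (e := ![m 0 0, m 0 1])
    (by intro j; fin_cases j; exacts [h.m_ne_zero 0 0, h.m_ne_zero 0 1]) h1
    (by
      intro s t
      fin_cases s <;> fin_cases t
      exacts [⟨1, by simp⟩, ⟨1, by simp⟩, ⟨κ, by simpa using hκ⟩, ⟨κ', by simpa using hκ'⟩])
  exact h'.false_of_right_diagonal hd hu h01

lemma false_of_left_perp_rows (hd : Accretive d₁ d₂) (h : ProductCode d₁ d₂ W a m)
    (h1 : star (a 0 0) ⬝ᵥ a 1 1 = 0) (h2 : star (a 0 0) ⬝ᵥ a 1 0 = 0) : False := by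
  obtain ⟨⟨κ, hκ⟩, κ', hκ'⟩ := parallel_of_perp (h.m_ne_zero 1 1) (h.m_ne_zero 1 0)
    (h.m_ne_zero 0 1) (h.a_ne_zero 0 0) (h.a_ne_zero 1 1) (h.a_ne_zero 1 0)
    (h.perp (by simp)).symm (h.perp (by simp)).symm (h.perp (by simp)).symm h1 h2
  obtain ⟨m', e', h', hu⟩ := h.normalize_left (fun s _ => s) (e := ![a 0 0, a 1 1])
    (by intro j; fin_cases j; exacts [h.a_ne_zero 0 0, h.a_ne_zero 1 1])
    (by
      intro s t
      fin_cases s <;> fin_cases t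
      exacts [⟨1, by simp⟩, ⟨κ', by simpa using hκ'⟩, ⟨κ, by simpa using hκ⟩, ⟨1, by simp⟩])
  exact h'.false_of_left_rows hd hu

/-- There is no product code for accretive diagonals. -/
lemma false (hd : Accretive d₁ d₂) (h : ProductCode d₁ d₂ W a m) : False := by
  rcases h.perp (s := 0) (t := 0) (s' := 0) (t' := 1) (by simp) with r | r <;>
  rcases h.perp (s := 0) (t := 0) (s' := 1) (t' := 0) (by simp) with t | t
  · obtain ⟨-, κ, hκ⟩ := parallel_of_perp (h.m_ne_zero 0 1) (h.m_ne_zero 1 0)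
      (h.m_ne_zero 1 1) (h.a_ne_zero 0 0) (h.a_ne_zero 0 1) (h.a_ne_zero 1 0)
      (h.perp (by simp)).symm (h.perp (by simp)).symm (h.perp (by simp)).symm r t
    exact h.left_not_parallel hd hκ
  · rcases h.perp (s := 0) (t := 0) (s' := 1) (t' := 1) (by simp) with q | q
    · exact h.swap.false_of_left_perp_rows hd.swap q r
    · exact h.false_of_right_perp_rows hd q t
  · rcases h.perp (s := 0) (t := 0) (s' := 1) (t' := 1) (by simp) with q | q
    · exact h.false_of_left_perp_rows hd q t
    · exact h.swap.false_of_right_perp_rows hd.swap q r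
  · exact h.false_of_right_perp_diagonal hd r t

end ProductCode

/-! ### Block codes of rank one and two -/

lemma IsScalar.of_smul {V : Type*} [AddCommGroup V] [Module ℂ V] {c : Fin 2 → Fin 2 → ℂ} {U : V}
    (hU : U ≠ 0) (h : IsScalar fun i j => c i j • U) : IsScalar c := by
  rw [isScalar_iff] at h ⊢
  simpa [hU, ← sub_eq_zero (a := c 0 0 • U), ← sub_smul, sub_eq_zero] using h

/-- A `2 × 2` array of rank at most one is scalar only if it vanishes. -/
lemma IsScalar.eq_zero_or {x y : Fin 2 → ℂ} (h : IsScalar fun i j => star (x i) * y j) :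
    x = 0 ∨ y = 0 := by
  obtain ⟨h1, h2, h3⟩ := (isScalar_iff _).1 h
  simp only [mul_eq_zero, star_eq_zero] at h1 h2
  by_contra! hne
  rcases h1 with h1 | h1 <;> rcases h2 with h2 | h2
  · exact hne.1 (by ext i; fin_cases i <;> simp [h1, h2])
  · simp only [h1, h2, star_zero, zero_mul, zero_eq_mul, star_eq_zero] at h3
    rcases h3 with h3 | h3
    · exact hne.1 (by ext i; fin_cases i <;> simp [h1, h3])
    · exact hne.2 (by ext i; fin_cases i <;> simp [h2, h3])
  · simp only [h1, h2, star_zero, mul_zero, mul_eq_zero, star_eq_zero] at h3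
    rcases h3 with h3 | h3
    · exact hne.1 (by ext i; fin_cases i <;> simp [h2, h3])
    · exact hne.2 (by ext i; fin_cases i <;> simp [h1, h3])
  · exact hne.2 (by ext i; fin_cases i <;> simp [h1, h2])

namespace BlockCode

variable {d₁ d₂ : Fin 2 → ℂ} {Z : Fin 2 → Fin 2 → Fin 2 → Matrix (Fin 2) (Fin 2) ℂ}

/-- All traces and products in `W` are nonzero, so the conditions concern `m` alone. They annihilate
three of the four vectors `m s t`, and the last cannot resolve a rank-two identity. -/
lemma false_of_rank_one (hd : Accretive d₁ d₂) (h : BlockCode d₁ d₂ Z)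
    {W : Matrix (Fin 2) (Fin 2) ℂ} (hW : W ≠ 0) {m : Fin 2 → Fin 2 → Fin 2 → ℂ}
    (hZ : ∀ i s t, Z i s t = m s t i • W)
    (hon : ∀ i j, ∑ s, ∑ t, star (m s t i) * m s t j = if i = j then 1 else 0) : False := by
  have hT : (Wᴴ * diagonal d₁ * W * diagonal d₂).trace ≠ 0 := fun h0 => by
    simpa [h0] using re_trace_pos hd.mul hW
  have hT' : (Wᴴ * diagonal d₁ * W * diagonal (star d₂)).trace ≠ 0 := fun h0 => by
    simpa [h0] using re_trace_pos hd.mul_star hW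
  have hL : Wᴴ * diagonal d₁ * W ≠ 0 := fun h0 => hW (eq_zero_of_left hd.left h0)
  have hR : W * diagonal d₂ * Wᴴ ≠ 0 := fun h0 => hW (eq_zero_of_right hd.right h0)
  have h1 := h.upper_upper
  have h2 := h.upper_lower
  have h3 := h.upper_diag
  have h4 := h.diag_upper
  simp only [hZ, conjTranspose_smul, Matrix.smul_mul, Matrix.mul_smul, trace_smul, smul_smul,
    ← add_smul] at h1 h2 h3 h4
  have h1 := (IsScalar.of_smul hT (c := fun i j => star (m 0 0 i) * m 1 1 j)
    (by simpa only [smul_smul, mul_comm] using h1)).eq_zero_or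
  have h2 := (IsScalar.of_smul hT' (c := fun i j => star (m 0 1 i) * m 1 0 j)
    (by simpa only [smul_smul, mul_comm] using h2)).eq_zero_or
  have h3 := IsScalar.of_smul hL
    (c := fun i j => star (m 0 0 i) * m 1 0 j + star (m 0 1 i) * m 1 1 j)
    (by simpa only [mul_comm] using h3)
  have h4 := IsScalar.of_smul hR
    (c := fun i j => star (m 0 0 i) * m 0 1 j + star (m 1 0 i) * m 1 1 j)
    (by simpa only [mul_comm] using h4)
  simp only [Fin.sum_univ_two] at hon
  have single : ∀ x : Fin 2 → ℂ,
      (∀ i j, star (x i) * x j = if i = j then 1 else 0) → False := by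
    intro x hx
    have hx' := IsScalar.eq_zero_or (x := x) (y := x) ⟨1, hx⟩
    have := hx 0 0
    simp only [or_self] at hx'
    simp [hx'] at this
  rcases h1 with h1 | h1 <;> rcases h2 with h2 | h2 <;>
    simp only [h1, h2, Pi.zero_apply, star_zero, zero_mul, mul_zero, zero_add, add_zero]
      at h3 h4 hon
  · rcases h4.eq_zero_or with h5 | h5 <;>
      exact single _ (fun i j => by simpa [h5] using hon i j)
  · rcases h3.eq_zero_or with h5 | h5 <;>
      exact single _ (fun i j => by simpa [h5] using hon i j)
  · rcases h3.eq_zero_or with h5 | h5 <;>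
      exact single _ (fun i j => by simpa [h5] using hon i j)
  · rcases h4.eq_zero_or with h5 | h5 <;>
      exact single _ (fun i j => by simpa [h5] using hon i j)

lemma star_dotProduct_mulVec_trace (W : Fin 2 → Matrix (Fin 2) (Fin 2) ℂ)
    (D E : Matrix (Fin 2) (Fin 2) ℂ) (a b : Fin 2 → ℂ) :
    star a ⬝ᵥ ((of fun c c' => ((W c)ᴴ * D * W c' * E).trace) *ᵥ b) =
      ((comb W a)ᴴ * D * comb W b * E).trace := by
  simp only [dotProduct, mulVec, Fin.sum_univ_two, of_apply, Pi.star_apply, comb,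
    conjTranspose_add, conjTranspose_smul, Matrix.add_mul, Matrix.mul_add, Matrix.smul_mul,
    Matrix.mul_smul, trace_add, trace_smul, smul_eq_mul]
  ring

/-- The Gram-type matrix `tr (W_c† d₁ W_c' e)` is accretive by `re_trace_pos`, so
`det_eq_zero_of_isScalar` applies to it. -/
lemma det_eq_zero {W : Fin 2 → Matrix (Fin 2) (Fin 2) ℂ} {e : Fin 2 → ℂ}
    (hd : ∀ x y, 0 < (d₁ x * e y).re) (hW : ∀ c, comb W c = 0 → c = 0)
    {p q : Matrix (Fin 2) (Fin 2) ℂ} (hp : p ≠ 0) (hq : q ≠ 0) (horth : (pᴴ * q).trace = 0)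
    (h : IsScalar fun i j => ((comb W fun c => p c i)ᴴ * diagonal d₁ * (comb W fun c => q c j) *
      diagonal e).trace) :
    p.det = 0 ∧ q.det = 0 ∧ ∀ i j, ((comb W fun c => p c i)ᴴ * diagonal d₁ *
      (comb W fun c => q c j) * diagonal e).trace = 0 := by
  obtain ⟨l, hl⟩ := h
  have key : pᴴ * (of fun c c' => ((W c)ᴴ * diagonal d₁ * W c' * diagonal e).trace) * q =
      l • (1 : Matrix (Fin 2) (Fin 2) ℂ) := by
    ext i j
    have : (pᴴ * (of fun c c' => ((W c)ᴴ * diagonal d₁ * W c' * diagonal e).trace) * q) i j =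
        star (fun c => p c i) ⬝ᵥ
          ((of fun c c' => ((W c)ᴴ * diagonal d₁ * W c' * diagonal e).trace) *ᵥ
            fun c => q c j) := by
      rw [Matrix.mul_assoc]
      rfl
    rw [this, star_dotProduct_mulVec_trace, Matrix.smul_apply, one_apply]
    refine (hl i j).trans ?_
    simp
  obtain ⟨h1, h2, rfl⟩ := det_eq_zero_of_isScalar (fun c hc => by
    rw [star_dotProduct_mulVec_trace]
    exact re_trace_pos hd fun h0 => hc (hW c h0)) key horth hp hq
  exact ⟨h1, h2, fun i j => (hl i j).trans (ite_self 0)⟩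

lemma comb_mul_right (W : Fin 2 → Matrix (Fin 2) (Fin 2) ℂ) (a : Fin 2 → ℂ) (c : ℂ) :
    (comb W fun k => a k * c) = c • comb W a := by
  rw [← comb_smul]
  congr 1
  ext k
  simp [mul_comm]

lemma false_of_rank_two (hd : Accretive d₁ d₂) (h : BlockCode d₁ d₂ Z)
    {W : Fin 2 → Matrix (Fin 2) (Fin 2) ℂ} (hW : ∀ c, comb W c = 0 → c = 0)
    {z : Fin 2 → Fin 2 → Matrix (Fin 2) (Fin 2) ℂ}
    (hZ : ∀ i s t, Z i s t = comb W fun c => z s t c i)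
    (hon : ∀ s t s' t', ((z s t)ᴴ * z s' t').trace = if (s, t) = (s', t') then 1 else 0) :
    False := by
  have hz : ∀ s t, z s t ≠ 0 := fun s t h0 => by simpa [h0] using hon s t s t
  have h1 := h.upper_upper
  have h2 := h.upper_lower
  have h3 := h.upper_diag
  have h4 := h.diag_upper
  simp only [hZ] at h1 h2 h3 h4
  obtain ⟨hdet00, hdet11, hpq⟩ := det_eq_zero hd.mul hW (hz 0 0) (hz 1 1) (by simp [hon]) h1
  obtain ⟨hdet01, hdet10, -⟩ := det_eq_zero hd.mul_star hW (hz 0 1) (hz 1 0) (by simp [hon]) h2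
  have hdet : ∀ s t, (z s t).det = 0 := by
    intro s t
    fin_cases s <;> fin_cases t <;> assumption
  choose a m ham using fun s t => exists_vecMulVec_of_det_eq_zero (hdet s t)
  have hm0 : ∀ s t, ∃ i, m s t i ≠ 0 := by
    intro s t
    by_contra! h0
    exact hz s t (by ext i j; simp [ham, vecMulVec_apply, h0])
  simp only [ham, vecMulVec_apply, comb_mul_right, conjTranspose_smul, Matrix.smul_mul,
    Matrix.mul_smul, trace_smul, smul_smul] at h3 h4 hpq
  have hon' : ∀ s t s' t', (star (a s t) ⬝ᵥ a s' t') * (star (m s t) ⬝ᵥ m s' t') =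
      if (s, t) = (s', t') then 1 else 0 := by
    intro s t s' t'
    rw [← hon, ham, ham, conjTranspose_vecMulVec, vecMulVec_mul_vecMulVec, trace_vecMulVec]
    simp [dotProduct_smul]
  refine ProductCode.false (W := W) (a := a) (m := m) hd
    { indep := hW
      norm := fun s t => by rw [hon', if_pos rfl]
      orth := fun s t s' t' hne => by rw [hon', if_neg hne]
      upper_upper := ?_
      upper_diag := ?_
      diag_upper := ?_ }
  · obtain ⟨i, hi⟩ := hm0 0 0
    obtain ⟨j, hj⟩ := hm0 1 1
    simpa [hi, hj] using hpq i j
  · simpa only [mul_comm] using h3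
  · simpa only [mul_comm] using h4

/-- There is no nonzero block code for accretive diagonals. -/
lemma false (hd : Accretive d₁ d₂) (h : BlockCode d₁ d₂ Z) (hne : ∃ s t, Z 0 s t ≠ 0) :
    False := by
  let F : Fin 2 → Matrix (Fin 2 × Fin 2) (Fin 2 × Fin 2) ℂ := fun i =>
    of fun k j => Z i k.1 k.2 j.1 j.2
  have hF : ∀ i j x y, ((F i)ᴴ * F j) x y =
      ∑ s, ∑ t, star (Z i s t x.1 x.2) * Z j s t y.1 y.2 := fun i j x y => by
    rw [mul_apply, Fintype.sum_prod_type]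
    rfl
  have h0 : (F 0)ᴴ * F 1 = 0 := by
    ext x y
    rw [hF]
    exact ((isScalar_iff _).1 (h.inner x.1 x.2 y.1 y.2)).1
  have h1 : (F 0)ᴴ * F 0 = (F 1)ᴴ * F 1 := by
    ext x y
    rw [hF, hF]
    exact ((isScalar_iff _).1 (h.inner x.1 x.2 y.1 y.2)).2.2
  obtain ⟨r, u, v, w, hu, hv, huv, hFu, hGv, hw⟩ := exists_common_decomposition _ _ h0 h1
  have hiso := isometry_of_orthonormal hu hv huv
  -- The `2 r` vectors `u`, `v` are orthonormal in `ℂ⁴`.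
  have hcard : r + r ≤ 4 := by
    have h2 := rank_mul_le_right (of fun k (a : Fin r ⊕ Fin r) => Sum.elim u v a k)ᴴ
      (of fun k (a : Fin r ⊕ Fin r) => Sum.elim u v a k)
    rw [hiso, rank_one] at h2
    simpa using h2.trans (rank_le_card_height _)
  have hFZ : ∀ i s t x y, Z i s t x y = F i (s, t) (x, y) := fun _ _ _ _ _ => rfl
  have hvu : ∀ a b, star (v a) ⬝ᵥ u b = 0 := fun a b => perp_comm (huv b a)
  have hr : r = 0 ∨ r = 1 ∨ r = 2 := by omega
  rcases hr with rfl | rfl | rfl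
  · obtain ⟨s, t, hst⟩ := hne
    apply hst
    ext x y
    simp [hFZ, hFu]
  · refine h.false_of_rank_one hd (W := of fun x y => w 0 (x, y))
      (m := fun s t => ![u 0 (s, t), v 0 (s, t)]) ?_ ?_ ?_
    · intro hW
      refine hw.ne_zero 0 ?_
      ext ⟨x, y⟩
      exact congrFun (congrFun hW x) y
    · intro i s t
      ext x y
      fin_cases i
      · simpa [F] using hFu (s, t) (x, y)
      · simpa [F] using hGv (s, t) (x, y)
    · intro i j
      have h2 := hu 0 0
      have h3 := hv 0 0
      have h4 := huv 0 0
      have h5 := hvu 0 0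
      simp only [dotProduct, Fintype.sum_prod_type, Pi.star_apply] at h2 h3 h4 h5
      fin_cases i <;> fin_cases j
      exacts [h2, h4, h5, h3]
  · refine h.false_of_rank_two hd (W := fun c => of fun x y => w c (x, y))
      (z := fun s t => of fun c => ![u c (s, t), v c (s, t)]) ?_ ?_ ?_
    · intro c hc
      ext k
      refine Fintype.linearIndependent_iff.1 hw c ?_ k
      ext ⟨x, y⟩
      simpa [comb, Fin.sum_univ_two] using congrFun (congrFun hc x) y
    · intro i s t
      ext x y
      fin_cases i
      · simpa [F, comb, Fin.sum_univ_two] using hFu (s, t) (x, y)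
      · simpa [F, comb, Fin.sum_univ_two] using hGv (s, t) (x, y)
    · intro s t s' t'
      -- For `r = 2` the isometry is square, hence unitary; orthonormality of its rows is that of
      -- the matrices `z s t`.
      have h2 := congrFun (congrFun ((mul_eq_one_comm_of_card_eq _ _ _ (by simp)).1 hiso) (s', t')) (s, t)
      rw [one_apply] at h2
      simp [mul_apply, Fin.sum_univ_two] at h2
      simp [trace, mul_apply, Fin.sum_univ_two]
      rw [if_congr (and_congr eq_comm eq_comm) rfl rfl, ← h2]
      ring

end BlockCode

/-! ### Accretivity of the phases; one and two parties -/

lemma phases_eq (θ : ℝ) : phases θ =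
    ![(Real.cos (θ / 2) : ℂ) + Real.sin (θ / 2) * Complex.I,
      (Real.cos (θ / 2) : ℂ) - Real.sin (θ / 2) * Complex.I] := by
  have : Complex.exp (Complex.I * (θ / 2)) =
      (Real.cos (θ / 2) : ℂ) + Real.sin (θ / 2) * Complex.I := by
    rw [mul_comm, Complex.exp_mul_I]
    push_cast
    rfl
  rw [phases, this]
  simp [sub_eq_add_neg, -Complex.ofReal_cos, -Complex.ofReal_sin]

/-- The real parts are `cos (θ₁/2)`, `cos (θ₂/2)` and `cos ((θ₁ ± θ₂)/2)`, with all angles in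
`(-π/2, π/2)`. -/
lemma accretive_phases {θ₁ θ₂ : ℝ} (h₁ : 0 < θ₁) (h₂ : 0 < θ₂) (h : θ₁ + θ₂ < Real.pi) :
    Accretive (phases θ₁) (phases θ₂) := by
  have c1 : 0 < Real.cos (θ₁ / 2) := Real.cos_pos_of_mem_Ioo ⟨by linarith, by linarith⟩
  have c2 : 0 < Real.cos (θ₂ / 2) := Real.cos_pos_of_mem_Ioo ⟨by linarith, by linarith⟩
  have cp : 0 < Real.cos (θ₁ / 2 + θ₂ / 2) :=
    Real.cos_pos_of_mem_Ioo ⟨by linarith, by linarith⟩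
  have cm : 0 < Real.cos (θ₁ / 2 - θ₂ / 2) :=
    Real.cos_pos_of_mem_Ioo ⟨by linarith, by linarith⟩
  rw [Real.cos_add] at cp
  rw [Real.cos_sub] at cm
  rw [phases_eq, phases_eq]
  generalize Real.cos (θ₁ / 2) = a at *
  generalize Real.cos (θ₂ / 2) = b at *
  generalize Real.sin (θ₁ / 2) = s at *
  generalize Real.sin (θ₂ / 2) = t at *
  constructor
  · intro x
    fin_cases x <;> simpa
  · intro x
    fin_cases x <;> simpa
  · intro x y
    fin_cases x <;> fin_cases y <;> simp <;> linarith
  · intro x y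
    fin_cases x <;> fin_cases y <;> simp <;> linarith

lemma eq_zero_of_isScalar_kronecker {θ₁ θ₂ : ℝ} (h₁ : 0 < θ₁) (h₂ : 0 < θ₂)
    (h : θ₁ + θ₂ < Real.pi) {φ : Fin 2 → Fin 4 × Fin 4 → ℂ}
    (hφ : ∀ A ∈ graphSpace θ₁, ∀ B ∈ graphSpace θ₂,
      IsScalar fun i j => sesq (kronecker A B) (φ i) (φ j)) : φ 0 = 0 := by
  by_contra hne
  exact (blockCode_of_isScalar hφ).false (accretive_phases h₁ h₂ h) (exists_block_ne_zero hne)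

lemma not_hasIndistinguishableSubspace_tensor {κ ι : Type*} {θ₁ θ₂ : ℝ} (h₁ : 0 < θ₁)
    (h₂ : 0 < θ₂) (h : θ₁ + θ₂ < Real.pi) {M : κ → Matrix (Fin 4) (Fin 4) ℂ}
    {N : ι → Matrix (Fin 4) (Fin 4) ℂ} (hM : IsBasisOf M (graphSpace θ₁))
    (hN : IsBasisOf N (graphSpace θ₂)) : ¬ HasIndistinguishableSubspace (tensor M N) := by
  intro hind
  obtain ⟨φ, hφ0, hφ⟩ := hind.exists_isScalar
  refine hφ0 (eq_zero_of_isScalar_kronecker h₁ h₂ h fun A hA B hB => ?_)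
  exact isScalar_sesq_kronecker hφ (hM.span_eq ▸ hA) (hN.span_eq ▸ hB)

lemma sesq_kronecker_prod {m n : Type*} [Fintype m] [Fintype n] (A : Matrix m m ℂ)
    (B : Matrix n n ℂ) (φ ψ : m → ℂ) (e : n → ℂ) :
    sesq (kronecker A B) (fun k => φ k.1 * e k.2) (fun k => ψ k.1 * e k.2) =
      sesq A φ ψ * sesq B e e := by
  rw [sesq_kronecker, sesq_eq_sum A, Finset.sum_mul]
  refine Finset.sum_congr rfl fun i _ => ?_
  rw [Finset.sum_mul]
  refine Finset.sum_congr rfl fun i' _ => ?_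
  rw [sesq_eq_sum B]
  simp only [Finset.mul_sum, star_mul']
  exact Finset.sum_congr rfl fun j _ => Finset.sum_congr rfl fun j' _ => by ring

lemma not_hasIndistinguishableSubspace {κ : Type*} {θ : ℝ} (h₀ : 0 < θ) (h : θ < Real.pi)
    {M : κ → Matrix (Fin 4) (Fin 4) ℂ} (hM : IsBasisOf M (graphSpace θ)) :
    ¬ HasIndistinguishableSubspace M := by
  intro hind
  obtain ⟨φ, hφ0, hφ⟩ := hind.exists_isScalar
  have hspan : ∀ A ∈ graphSpace θ, IsScalar fun i j => sesq A (φ i) (φ j) := by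
    intro A hA
    refine isScalar_sesq_of_mem_span LinearMap.id φ ?_ (hM.span_eq ▸ hA)
    rintro _ ⟨k, rfl⟩
    exact hφ k
  -- The second party is auxiliary: any positive angle below `π - θ` serves, and its vector is
  -- constantly `1`.
  have := eq_zero_of_isScalar_kronecker (θ₂ := (Real.pi - θ) / 2) h₀ (by linarith) (by linarith)
    (φ := fun i k => φ i k.1 * 1) fun A hA B _ => by
      obtain ⟨Λ, hΛ⟩ := hspan A hA
      refine ⟨Λ * sesq B (fun _ => 1) (fun _ => 1), fun i j => ?_⟩
      refine (sesq_kronecker_prod A B (φ i) (φ j) (fun _ => 1)).trans ?_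
      rw [show sesq A (φ i) (φ j) = _ from hΛ i j]
      split_ifs <;> simp
  apply hφ0
  ext x
  simpa using congrFun this (x, 0)

/-! ### The indistinguishable plane for three parties -/

section Tripartite

variable {n : Type*} [Fintype n]

lemma vecMulVec_mul_mul_vecMulVec (A : Matrix n n ℂ) (x y : n → ℂ) :
    vecMulVec x (star x) * A * vecMulVec y (star y) = sesq A x y • vecMulVec x (star y) := by
  rw [vecMulVec_mul, vecMulVec_mul_vecMulVec, ← dotProduct_mulVec, ← sesq, ← smul_vecMulVec]
  ext i j
  simp [vecMulVec_apply, mul_assoc, mul_comm]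

/-- The Knill–Laflamme conditions imply indistinguishability. -/
lemma isIndistinguishable_span {κ : Type*} (M : κ → Matrix n n ℂ)
    {f g : EuclideanSpace ℂ n} (hf : star f.ofLp ⬝ᵥ f.ofLp = 1) (hg : star g.ofLp ⬝ᵥ g.ofLp = 1)
    (hfg : star f.ofLp ⬝ᵥ g.ofLp = 0)
    (h : ∀ k, sesq (M k) f.ofLp g.ofLp = 0 ∧ sesq (M k) g.ofLp f.ofLp = 0 ∧
      sesq (M k) f.ofLp f.ofLp = sesq (M k) g.ofLp g.ofLp) :
    IsIndistinguishable M (Submodule.span ℂ {f, g}) := by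
  have hgf := perp_comm hfg
  set P : Matrix n n ℂ :=
    vecMulVec f.ofLp (star f.ofLp) + vecMulVec g.ofLp (star g.ofLp) with hP
  have hPH : Pᴴ = P := by
    simp [hP, conjTranspose_vecMulVec]
  have key : ∀ ρ : Matrix n n ℂ, IsState ρ → SupportedBy ρ (Submodule.span ℂ {f, g}) →
      ∀ k, (ρ * M k).trace = sesq (M k) f.ofLp f.ofLp := by
    intro ρ hρ hsup k
    have h1 : P * ρ = ρ := by
      rw [ext_iff_mulVec]
      intro v
      obtain ⟨c, d, hcd⟩ := Submodule.mem_span_pair.1 (hsup v)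
      have hv : ρ *ᵥ v = c • f.ofLp + d • g.ofLp := (congrArg WithLp.ofLp hcd).symm
      rw [← mulVec_mulVec, hv, hP]
      simp [add_mulVec, mulVec_add, mulVec_smul, vecMulVec_mulVec, hf, hg, hfg, hgf]
    have h2 : ρ * P = ρ := by
      have := congrArg conjTranspose h1
      rwa [conjTranspose_mul, hPH, hρ.posSemidef.isHermitian.eq] at this
    -- The Knill–Laflamme conditions in projection form: each effect compresses to a multiple of the
    -- projection `P`.
    have h3 : P * M k * P = sesq (M k) f.ofLp f.ofLp • P := by
      rw [hP]
      simp only [Matrix.add_mul, Matrix.mul_add, vecMulVec_mul_mul_vecMulVec, (h k).1, (h k).2.1,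
        ← (h k).2.2, zero_smul, add_zero, zero_add, smul_add]
    calc (ρ * M k).trace = (P * (ρ * (P * M k))).trace := by
          rw [← Matrix.mul_assoc ρ, h2, ← Matrix.mul_assoc P, h1]
      _ = (ρ * (P * M k * P)).trace := by
          rw [trace_mul_comm]; simp only [Matrix.mul_assoc]
      _ = _ := by rw [h3, Matrix.mul_smul, h2, trace_smul, hρ.trace_eq_one, smul_eq_mul, mul_one]
  intro ρ σ hρ hσ hsρ hsσ
  ext k
  rw [outcomeDistribution, outcomeDistribution, key ρ hρ hsρ, key σ hσ hsσ]

lemma finrank_span_pair_of_orthonormal {f g : EuclideanSpace ℂ n}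
    (hf : star f.ofLp ⬝ᵥ f.ofLp = 1) (hg : star g.ofLp ⬝ᵥ g.ofLp = 1)
    (hfg : star f.ofLp ⬝ᵥ g.ofLp = 0) :
    Module.finrank ℂ (Submodule.span ℂ {f, g}) = 2 := by
  have hgf := perp_comm hfg
  have hli : LinearIndependent ℂ ![f, g] := by
    rw [LinearIndependent.pair_iff]
    intro s t hst
    have hst' : s • f.ofLp + t • g.ofLp = 0 := congrArg WithLp.ofLp hst
    have h1 := congrArg (star f.ofLp ⬝ᵥ ·) hst'
    have h2 := congrArg (star g.ofLp ⬝ᵥ ·) hst'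
    simp [dotProduct_add, dotProduct_smul, hf, hg, hfg, hgf] at h1 h2
    exact ⟨h1, h2⟩
  have := finrank_span_eq_card hli
  rwa [range_cons, range_cons, range_empty, Set.union_empty, Set.singleton_union,
    Fintype.card_fin] at this

lemma sesq_single [DecidableEq n] (A : Matrix n n ℂ) (i j : n) :
    sesq A (Pi.single i 1) (Pi.single j 1) = A i j := by
  rw [sesq, ← Pi.single_star, star_one]
  simp

lemma sesq_ket3_pair (A : Matrix (Fin 4 × Fin 4 × Fin 4) (Fin 4 × Fin 4 × Fin 4) ℂ)
    (i j k l : Fin 4) :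
    sesq A (((1 / Real.sqrt 2 : ℝ) : ℂ) • (ket3 i + Complex.I • ket3 j)).ofLp
      (((1 / Real.sqrt 2 : ℝ) : ℂ) • (ket3 k + Complex.I • ket3 l)).ofLp =
    (1 / 2) * (A (i, i, i) (k, k, k) + Complex.I * A (i, i, i) (l, l, l) -
      Complex.I * A (j, j, j) (k, k, k) + A (j, j, j) (l, l, l)) := by
  have hk : ∀ i, (ket3 i).ofLp = Pi.single (i, i, i) 1 := fun i => rfl
  have hc : ((1 / Real.sqrt 2 : ℝ) : ℂ) * ((1 / Real.sqrt 2 : ℝ) : ℂ) = 1 / 2 := by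
    rw [← Complex.ofReal_mul, div_mul_div_comm, Real.mul_self_sqrt (by norm_num)]
    norm_num
  simp only [WithLp.ofLp_smul, WithLp.ofLp_add, hk, sesq_smul_left, sesq_smul_right,
    sesq_add_left, sesq_add_right, sesq_single]
  rw [← hc, Complex.star_def, Complex.conj_ofReal, Complex.conj_I]
  linear_combination (-((1 / Real.sqrt 2 : ℝ) : ℂ) * ((1 / Real.sqrt 2 : ℝ) : ℂ) *
    A (j, j, j) (l, l, l)) * Complex.I_sq

lemma phi_psi_orthonormal : star phi.ofLp ⬝ᵥ phi.ofLp = 1 ∧ star psi.ofLp ⬝ᵥ psi.ofLp = 1 ∧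
    star phi.ofLp ⬝ᵥ psi.ofLp = 0 := by
  have h : ∀ x y : Fin 4 × Fin 4 × Fin 4 → ℂ, star x ⬝ᵥ y = sesq 1 x y := fun x y => by
    simp [sesq]
  simp only [h, phi, psi, sesq_ket3_pair]
  refine ⟨?_, ?_, ?_⟩ <;> simp [one_apply] <;> norm_num

/-- The span of `phi` and `psi` satisfies the Knill–Laflamme conditions if the phases add up
to `π`. -/
lemma sesq_phi_psi {θ : Fin 3 → ℝ} (hsum : θ 0 + θ 1 + θ 2 = Real.pi)
    {A B C : Matrix (Fin 4) (Fin 4) ℂ} (hA : A ∈ graphSpace (θ 0)) (hB : B ∈ graphSpace (θ 1))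
    (hC : C ∈ graphSpace (θ 2)) :
    sesq (kronecker A (kronecker B C)) phi.ofLp psi.ofLp = 0 ∧
    sesq (kronecker A (kronecker B C)) psi.ofLp phi.ofLp = 0 ∧
    sesq (kronecker A (kronecker B C)) phi.ofLp phi.ofLp =
      sesq (kronecker A (kronecker B C)) psi.ofLp psi.ofLp := by
  have hγ : Complex.exp (Complex.I * θ 0) * Complex.exp (Complex.I * θ 1) *
      Complex.exp (Complex.I * θ 2) = -1 := by
    rw [← Complex.exp_add, ← Complex.exp_add, ← mul_add, ← mul_add, ← Complex.ofReal_add,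
      ← Complex.ofReal_add, hsum, mul_comm, Complex.exp_pi_mul_I]
  have hγ' := congrArg star hγ
  simp only [star_mul', star_neg, star_one] at hγ'
  obtain ⟨a, b, c, d, e, f, g, h, rfl⟩ := hA
  obtain ⟨a', b', c', d', e', f', g', h', rfl⟩ := hB
  obtain ⟨a'', b'', c'', d'', e'', f'', g'', h'', rfl⟩ := hC
  simp only [phi, psi, sesq_ket3_pair]
  generalize Complex.exp (Complex.I * θ 0) = x at *
  generalize Complex.exp (Complex.I * θ 1) = y at *
  generalize Complex.exp (Complex.I * θ 2) = z at *
  refine ⟨?_, ?_, ?_⟩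
  · simp [kronecker, kroneckerMap_apply]
    simp only [Complex.star_def] at hγ'
    linear_combination e * e' * e'' * hγ'
  · simp [kronecker, kroneckerMap_apply]
    linear_combination g * g' * g'' * hγ
  · simp [kronecker, kroneckerMap_apply]

end Tripartite

end NPartite

theorem corollary2 (θ : Fin 3 → ℝ) (hpos : ∀ i, 0 < θ i)
    (hsum : θ 0 + θ 1 + θ 2 = Real.pi)
    (M : Fin 3 → Fin 8 → Matrix (Fin 4) (Fin 4) ℂ)
    (hobs : ∀ i, NPartite.IsObservable (M i))
    (hbasis : ∀ i, NPartite.IsBasisOf (M i) (NPartite.graphSpace (θ i))) :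
    (∀ i, ¬ NPartite.HasIndistinguishableSubspace (M i)) ∧
    (∀ i j, i ≠ j →
      ¬ NPartite.HasIndistinguishableSubspace (NPartite.tensor (M i) (M j))) ∧
    Module.finrank ℂ (Submodule.span ℂ {NPartite.phi, NPartite.psi}) = 2 ∧
    NPartite.IsIndistinguishable
      (NPartite.tensor (M 0) (NPartite.tensor (M 1) (M 2)))
      (Submodule.span ℂ {NPartite.phi, NPartite.psi}) := by
  have h0 := hpos 0
  have h1 := hpos 1
  have h2 := hpos 2
  obtain ⟨hf, hg, hfg⟩ := NPartite.phi_psi_orthonormal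
  refine ⟨fun i => ?_, fun i j hij => ?_, NPartite.finrank_span_pair_of_orthonormal hf hg hfg,
    NPartite.isIndistinguishable_span _ hf hg hfg fun k => ?_⟩
  · refine NPartite.not_hasIndistinguishableSubspace (hpos i) ?_ (hbasis i)
    fin_cases i <;> simp <;> linarith
  · refine NPartite.not_hasIndistinguishableSubspace_tensor (hpos i) (hpos j) ?_ (hbasis i)
      (hbasis j)
    fin_cases i <;> fin_cases j <;> simp at hij ⊢ <;> linarith
  · have hmem : ∀ i l, M i l ∈ NPartite.graphSpace (θ i) := fun i l =>
      (hbasis i).span_eq ▸ Submodule.subset_span ⟨l, rfl⟩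
    exact NPartite.sesq_phi_psi hsum (hmem 0 _) (hmem 1 _) (hmem 2 _)
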